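/- Write $\mathrm{Sym}_5$ for the 15-dimensional space of real symmetric $5\times5$ matrices with inner product $\langle A,M\rangle=\operatorname{trace}(A^{\mathsf T}M)$, $\mathcal{CP}_5$ for the cone of all $BB^{\mathsf T}$ with $B$ an entrywise nonnegative $5\times k$ matrix (any $k$), and $\mathcal{DNN}_5^\circ$ for the interior, in $\mathrm{Sym}_5$, of the cone of positive semidefinite matrices with nonnegative entries. For $\Theta=(\theta_1,\dots,\theta_5)$ with all $\theta_i>0$ and $\sum_i\theta_i<\pi$ let \[ T(\Theta)=\begin{pmatrix} 1&-\cos\theta_1&\cos(\theta_1+\theta_2)&\cos(\theta_4+\theta_5)&-\cos\theta_5\\ -\cos\theta_1&1&-\cos\theta_2&\cos(\theta_2+\theta_3)&\cos(\theta_5+\theta_1)\\ \cos(\theta_1+\theta_2)&-\cos\theta_2&1&-\cos\theta_3&\cos(\theta_3+\theta_4)\\ \cos(\theta_4+\theta_5)&\cos(\theta_2+\theta_3)&-\cos\theta_3&1&-\cos\theta_4\\ -\cos\theta_5&\cos(\theta_5+\theta_1)&\cos(\theta_3+\theta_4)&-\cos\theta_4&1 \end{pmatrix}, \] \[ S(\Theta)=\begin{pmatrix}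 \sin\theta_5&0&0&\sin\theta_2&\sin(\theta_3+\theta_4)\\ \sin(\theta_4+\theta_5)&\sin\theta_1&0&0&\sin\theta_3\\ \sin\theta_4&\sin(\theta_5+\theta_1)&\sin\theta_2&0&0\\ 0&\sin\theta_5&\sin(\theta_1+\theta_2)&\sin\theta_3&0\\ 0&0&\sin\theta_1&\sin(\theta_3+\theta_2)&\sin\theta_4 \end{pmatrix}. \] Let the Hildebrand locus $V_{Hi}$ be the set of all $A\in\mathcal{CP}_5\cap\mathcal{DNN}_5^\circ$ with $\langle A,D\,T(\Theta)D\rangle=0$ for some such $\Theta$ and some diagonal matrix $D$ with positive diagonal entries. Let $W$ be the 15-dimensional space of real matrices of the form \[ \begin{pmatrix} y_{11}&0&0&y_{41}&y_{51}\\ y_{12}&y_{22}&0&0&y_{52}\\ y_{13}&y_{23}&y_{33}&0&0\\ 0&y_{24}&y_{34}&y_{44}&0\\ 0&0&y_{35}&y_{45}&y_{55} \end{pmatrix}, \] $W_{\ge0}$ its subset of matrices with nonnegative entries, and $\varphi:W\to\mathrm{Sym}_5$, $\varphi(X)=XX^{\mathsf T}$. Let $f=y_{11}y_{22}y_{33}y_{44}y_{55}-y_{13}y_{24}y_{35}y_{41}y_{52}$,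 let $Z_{Hi}\subset W$ be the set of real zeros of $f$, and let $\tilde Z_{Hi}\subset W$ be the set of all matrices $D_1S(\Theta)D_2$, where $D_1,D_2$ are diagonal with positive diagonal entries and $\Theta$ is as above. Zariski closures are taken over $\mathbb R$, in $W$ and in $\mathrm{Sym}_5$. Then: 1. $f$ is irreducible and generates the ideal of all real polynomials on $W$ that vanish on $Z_{Hi}$; and the ideal of all real polynomials on $\mathrm{Sym}_5$ that vanish on $V_{Hi}$ is generated by one irreducible polynomial. So $Z_{Hi}$ and the Zariski closure of $V_{Hi}$ are irreducible hypersurfaces. 2. $V_{Hi}=\varphi(\tilde Z_{Hi})$, and for every $X\in W_{\ge0}$ one has $\varphi(X)\in V_{Hi}$ if and only if $X\in\tilde Z_{Hi}$. 3. The Zariski closure of $\tilde Z_{Hi}$ is $Z_{Hi}$, and $V_{Hi}$, $\varphi(Z_{Hi})$ and $\varphi(Z_{Hi}\cap W_{\ge0})$ have the same Zariski closure. -/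

import Mathlib

open scoped Matrix

noncomputable section

namespace CPFive

/-- The space of real symmetric `n × n` matrices, as a linear subspace of all matrices. -/
def symMatrices (n : ℕ) : Submodule ℝ (Matrix (Fin n) (Fin n) ℝ) where
  carrier := {A | A.IsSymm}
  add_mem' := fun hA hB => Matrix.IsSymm.add hA hB
  zero_mem' := Matrix.isSymm_zero
  smul_mem' := fun c _ hA => Matrix.IsSymm.smul hA c

/-- The completely positive cone: all `B Bᵀ` with `B` an entrywise nonnegative `n × k` matrix,
for some `k`. -/
def completelyPositive (n : ℕ) : Set (Matrix (Fin n) (Fin n) ℝ) :=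
  {A | ∃ (k : ℕ) (B : Matrix (Fin n) (Fin k) ℝ), (∀ i j, 0 ≤ B i j) ∧ A = B * Bᵀ}

/-- The doubly nonnegative cone: positive semidefinite matrices with nonnegative entries. -/
def doublyNonneg (n : ℕ) : Set (Matrix (Fin n) (Fin n) ℝ) :=
  {A | A.PosSemidef ∧ ∀ i j, 0 ≤ A i j}

/-- The interior of the doubly nonnegative cone, relative to the space of symmetric matrices. -/
def doublyNonnegInterior (n : ℕ) : Set (Matrix (Fin n) (Fin n) ℝ) :=
  (Subtype.val : symMatrices n → Matrix (Fin n) (Fin n) ℝ) ''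
    interior ((Subtype.val : symMatrices n → Matrix (Fin n) (Fin n) ℝ) ⁻¹' doublyNonneg n)

/-- The parameters `Θ = (θ₁, …, θ₅)`: positive reals with sum less than `π`. The coordinate `θᵢ`
is `θ (i - 1)`. -/
def angles : Set (Fin 5 → ℝ) :=
  {θ | (∀ i, 0 < θ i) ∧ ∑ i, θ i < Real.pi}

open Real in
/-- The Hildebrand matrix `T(Θ)`. -/
def hildT (θ : Fin 5 → ℝ) : Matrix (Fin 5) (Fin 5) ℝ :=
  !![1, -cos (θ 0), cos (θ 0 + θ 1), cos (θ 3 + θ 4), -cos (θ 4);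
     -cos (θ 0), 1, -cos (θ 1), cos (θ 1 + θ 2), cos (θ 4 + θ 0);
     cos (θ 0 + θ 1), -cos (θ 1), 1, -cos (θ 2), cos (θ 2 + θ 3);
     cos (θ 3 + θ 4), cos (θ 1 + θ 2), -cos (θ 2), 1, -cos (θ 3);
     -cos (θ 4), cos (θ 4 + θ 0), cos (θ 2 + θ 3), -cos (θ 3), 1]

open Real in
/-- The matrix `S(Θ)`. -/
def hildS (θ : Fin 5 → ℝ) : Matrix (Fin 5) (Fin 5) ℝ :=
  !![sin (θ 4), 0, 0, sin (θ 1), sin (θ 2 + θ 3);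
     sin (θ 3 + θ 4), sin (θ 0), 0, 0, sin (θ 2);
     sin (θ 3), sin (θ 4 + θ 0), sin (θ 1), 0, 0;
     0, sin (θ 4), sin (θ 0 + θ 1), sin (θ 2), 0;
     0, 0, sin (θ 0), sin (θ 2 + θ 1), sin (θ 3)]

/-- The Hildebrand locus: the matrices in `CP₅ ∩ int(DNN₅)` that are orthogonal, for the inner
product `⟨A, M⟩ = trace (Aᵀ M)`, to `D T(Θ) D` for some positive diagonal `D` and some `Θ`. -/
def hildLocus : Set (Matrix (Fin 5) (Fin 5) ℝ) :=
  {A | A ∈ completelyPositive 5 ∩ doublyNonnegInterior 5 ∧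
    ∃ θ ∈ angles, ∃ d : Fin 5 → ℝ, (∀ i, 0 < d i) ∧
      Matrix.trace (Aᵀ * (Matrix.diagonal d * hildT θ * Matrix.diagonal d)) = 0}

/-- Index set of the 15 coordinates `y_{jk}` of `W`: the pair `(j, k)` stands for the entry in
column `j` and row `k`, where `k ∈ {j, j + 1, j + 2}` modulo 5. -/
abbrev WIndex : Type := {p : Fin 5 × Fin 5 // p.2 = p.1 ∨ p.2 = p.1 + 1 ∨ p.2 = p.1 + 2}

/-- The index of the coordinate `y_{jk}`, with `j` and `k` counted from zero. -/
def ix (j k : Fin 5) (h : k = j ∨ k = j + 1 ∨ k = j + 2 := by decide) : WIndex := ⟨(j, k), h⟩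

/-- The matrix in `W` with coordinates `y`; this identifies `W` with `WIndex → ℝ`. -/
def wMatrix (y : WIndex → ℝ) : Matrix (Fin 5) (Fin 5) ℝ :=
  !![y (ix 0 0), 0, 0, y (ix 3 0), y (ix 4 0);
     y (ix 0 1), y (ix 1 1), 0, 0, y (ix 4 1);
     y (ix 0 2), y (ix 1 2), y (ix 2 2), 0, 0;
     0, y (ix 1 3), y (ix 2 3), y (ix 3 3), 0;
     0, 0, y (ix 2 4), y (ix 3 4), y (ix 4 4)]

/-- The map `φ : W → Sym₅`, `φ(X) = X Xᵀ`. -/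
def phi (y : WIndex → ℝ) : Matrix (Fin 5) (Fin 5) ℝ :=
  wMatrix y * (wMatrix y)ᵀ

open MvPolynomial in
/-- The polynomial `y₁₁ y₂₂ y₃₃ y₄₄ y₅₅ - y₁₃ y₂₄ y₃₅ y₄₁ y₅₂` in the coordinate ring of `W`. -/
def hildBinomial : MvPolynomial WIndex ℝ :=
  X (ix 0 0) * X (ix 1 1) * X (ix 2 2) * X (ix 3 3) * X (ix 4 4)
    - X (ix 0 2) * X (ix 1 3) * X (ix 2 4) * X (ix 3 0) * X (ix 4 1)

/-- The variety `Z_Hi ⊆ W` of the ideal generated by the binomial. -/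
def hildZ : Set (WIndex → ℝ) :=
  MvPolynomial.zeroLocus ℝ (Ideal.span {hildBinomial})

/-- The entrywise nonnegative points of `W`. -/
def wNonneg : Set (WIndex → ℝ) := {y | ∀ p, 0 ≤ y p}

/-- The matrices in `W` of the form `D₁ S(Θ) D₂` with positive diagonal `D₁`, `D₂`. -/
def hildFactors : Set (WIndex → ℝ) :=
  {y | ∃ θ ∈ angles, ∃ d₁ d₂ : Fin 5 → ℝ, (∀ i, 0 < d₁ i) ∧ (∀ i, 0 < d₂ i) ∧
    wMatrix y = Matrix.diagonal d₁ * hildS θ * Matrix.diagonal d₂}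

/-- Index set of the 15 coordinates of `Sym₅` (the entries on and above the diagonal). -/
abbrev SymIndex : Type := {p : Fin 5 × Fin 5 // p.1 ≤ p.2}

/-- The linear coordinates of a symmetric matrix; they identify `Sym₅` with `SymIndex → ℝ`. -/
def symCoord (A : Matrix (Fin 5) (Fin 5) ℝ) : SymIndex → ℝ := fun p => A p.1.1 p.1.2

/-- The Zariski closure of a set of real points: the common zeros of all real polynomials that
vanish on the set. -/
def zariskiClosure {σ : Type} (S : Set (σ → ℝ)) : Set (σ → ℝ) :=
  MvPolynomial.zeroLocus ℝ (MvPolynomial.vanishingIdeal ℝ S)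

/-- The ideal of all real polynomials vanishing on `S` is generated by one irreducible polynomial,
that is, the Zariski closure of `S` is an irreducible hypersurface. (The ideal is what has to be
principal: over the reals the zero set of a single polynomial can have any codimension.) -/
def IsZariskiHypersurface {σ : Type} (S : Set (σ → ℝ)) : Prop :=
  ∃ F : MvPolynomial σ ℝ, Irreducible F ∧ MvPolynomial.vanishingIdeal ℝ S = Ideal.span {F}

end CPFive

end

/-! ### The Jacobian criterion for algebraic independence. -/

section Jacobian

open MvPolynomial

variable {k ι S : Type*} [Field k] [CommRing S] [Algebra k S]

/-! For `A = B Bᵀ`, the inner product of `A` with `D T(Θ) D` is the sum of the values of the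
quadratic form of `T(Θ)` at the columns of `D B`. That form is nonnegative on the nonnegative
orthant (`hildForm_nonneg`), so orthogonality makes every column a zero of it, and its nonnegative
zeros are the multiples of five vectors, the columns of `S` with cyclically shifted angles
(`exists_eq_column`). Merging proportional columns leaves a factor `D₁ S(Θ) D₂`. All five columns
occur, because entry `(k, k + 2)` of `A` is positive and comes from column `k` alone. Conversely,
the columns of `S` are linearly independent (`eq_zero_of_column_relations`), so these products are
positive definite with positive entries, hence interior. This gives `hildLocus_eq`.

For the algebraic claims, the substitution `u = tan (π / 4 - θ / 2)` puts the matrices `D₁ S(Θ) D₂`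
in the image of a polynomial map in 15 parameters, and a product of infinite parameter sets maps
into them. Vanishing ideals therefore become kernels of ring maps (`vanishingIdeal_hildFactors`,
`vanishingIdeal_phi_hildFactors`). A Jacobian at a single point shows that 14 entries of the
parametrized `X Xᵀ` are algebraically independent. Both kernels are thus primes in 15 variables
whose quotients have transcendence degree at least 14; they are nonzero, the first because it
contains the binomial and the second by counting dimensions, and hence principal
(`ker_eq_span_of_irreducible`). The statements on closures follow because `hildFactors` and `hildZ`
have the same ideal. -/

theorem MvPolynomial.totalDegree_pderiv_le {n : ℕ} {G : MvPolynomial ι k}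
    (hG : G.totalDegree ≤ n + 1) (i : ι) : (pderiv i G).totalDegree ≤ n := by
  classical
  refine Finset.sup_le fun m hm => ?_
  rw [mem_support_iff, coeff_pderiv] at hm
  have h := (le_totalDegree (mem_support_iff.2 (left_ne_zero_of_mul hm))).trans hG
  rw [Finsupp.sum_add_index' (fun _ => rfl) (fun _ _ _ => rfl), Finsupp.sum_single_index rfl] at h
  omega

theorem MvPolynomial.eq_C_of_pderiv_eq_zero [CharZero k] {G : MvPolynomial ι k}
    (hG : ∀ i, pderiv i G = 0) : G = C (coeff 0 G) := by
  classical
  ext m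
  rw [coeff_C]
  split_ifs with h
  · rw [h]
  · obtain ⟨i, hi⟩ : ∃ i, m i ≠ 0 := by
      by_contra! hc
      exact h (Finsupp.ext fun i => (hc i).symm)
    -- This coefficient of the derivative is `m i` times the coefficient of `G` at `m`, and `m i` is
    -- invertible in characteristic zero.
    have := congrArg (coeff (m - Finsupp.single i 1)) (hG i)
    rw [coeff_pderiv, coeff_zero, tsub_add_cancel_of_le (by simpa using Nat.one_le_iff_ne_zero.2 hi)]
      at this
    refine (mul_eq_zero.1 this).resolve_right ?_
    exact Nat.cast_add_one_ne_zero _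

theorem MvPolynomial.derivation_aeval [Fintype ι] (D : Derivation k S S) (a : ι → S)
    (G : MvPolynomial ι k) : D (aeval a G) = ∑ i, aeval a (pderiv i G) * D (a i) := by
  classical
  induction G using MvPolynomial.induction_on with
  | C c => simp
  | add p q hp hq => simp [hp, hq, add_mul, Finset.sum_add_distrib]
  | mul_X p j hp =>
    simp only [map_mul, aeval_X, Derivation.leibniz, hp, smul_eq_mul, pderiv_X, map_add, add_mul,
      Finset.sum_add_distrib]
    congr 1
    · rw [Finset.sum_eq_single j]
      · simp
      · intro b _ hb
        simp [Pi.single_eq_of_ne hb.symm]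
      · simp
    · rw [Finset.mul_sum]
      exact Finset.sum_congr rfl fun i _ => by ring

/-- The Jacobian criterion for algebraic independence: it suffices that the Jacobian matrix is
injective at one point. -/
theorem algebraicIndependent_of_jacobian [CharZero k] [IsDomain S] [Fintype ι]
    (D : ι → Derivation k S S) (a : ι → S) (ev : S →ₐ[k] k)
    (h : ∀ v : ι → k, (∀ j, ∑ i, ev (D j (a i)) * v i = 0) → v = 0) :
    AlgebraicIndependent k a := by
  classical
  let M : Matrix ι ι S := Matrix.of fun j i => D j (a i)
  have hM : M.det ≠ 0 := by
    intro h0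
    have h1 : (M.map ev).det = 0 := by
      have := AlgHom.map_det ev M
      rw [h0, map_zero] at this
      exact this.symm
    obtain ⟨v, hv, hv'⟩ := Matrix.exists_mulVec_eq_zero_iff.2 h1
    exact hv (h v fun j => congrFun hv' j)
  rw [algebraicIndependent_iff]
  suffices ∀ n, ∀ G : MvPolynomial ι k, G.totalDegree ≤ n → aeval a G = 0 → G = 0 from
    fun G => this _ G le_rfl
  -- By the chain rule, differentiating a relation `G(a) = 0` puts the vector of values `∂ᵢG(a)` in
  -- the kernel of the nonsingular Jacobian. The partial derivatives are then relations of smaller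
  -- degree, which drives the induction.
  have key : ∀ G : MvPolynomial ι k, aeval a G = 0 → ∀ i, aeval a (pderiv i G) = 0 := by
    intro G hG
    refine congrFun (Matrix.eq_zero_of_mulVec_eq_zero hM (v := fun i => aeval a (pderiv i G)) ?_)
    funext j
    have := derivation_aeval (D j) a G
    rw [hG, map_zero] at this
    simp only [Matrix.mulVec, dotProduct, Pi.zero_apply, M, Matrix.of_apply]
    rw [this]
    exact Finset.sum_congr rfl fun i _ => mul_comm _ _
  have const : ∀ c : k, aeval a (C c : MvPolynomial ι k) = 0 → (C c : MvPolynomial ι k) = 0 := by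
    intro c hc
    rw [← algebraMap_eq, AlgHom.commutes] at hc
    have : ev (algebraMap k S c) = 0 := by rw [hc, map_zero]
    rw [AlgHom.commutes] at this
    rw [show c = 0 from this, C_0]
  intro n
  induction n with
  | zero =>
    intro G hd hG
    rw [(totalDegree_eq_zero_iff_eq_C).1 (Nat.le_zero.1 hd)] at hG ⊢
    exact const _ hG
  | succ n ih =>
    intro G hd hG
    have h0 := eq_C_of_pderiv_eq_zero fun i => ih _ (totalDegree_pderiv_le hd i) (key G hG i)
    rw [h0] at hG ⊢
    exact const _ hG

end Jacobian

/-! ### Transcendence degree and principal kernels. -/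

section Trdeg

open Cardinal MvPolynomial Algebra

/-- If the degree did not drop, lifts of a transcendence basis of `C` would be a transcendence basis
of `B`. A nonzero kernel element would then divide a nonzero polynomial in the lifts, whose image is
a forbidden relation in `C`. -/
theorem trdeg_lt_of_surjective_of_not_injective {k B C : Type} [Field k] [CommRing B] [IsDomain B]
    [CommRing C] [IsDomain C] [Algebra k B] [Algebra k C] (f : B →ₐ[k] C)
    (hf : Function.Surjective f) (hi : ¬ Function.Injective f) (hB : trdeg k B < ℵ₀) :
    trdeg k C < trdeg k B := by
  by_contra! hle
  apply hi
  obtain ⟨s, hs⟩ := exists_isTranscendenceBasis k C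
  choose b hb using fun x : s => hf x.1
  have hbi : AlgebraicIndependent k b := by
    refine AlgebraicIndependent.of_comp f ?_
    rw [show f ∘ b = fun x : s => (x : C) from funext hb]
    exact hs.1
  have hbt := hbi.isTranscendenceBasis_of_trdeg_le hB (hle.trans hs.cardinalMk_eq_trdeg.ge)
  rw [injective_iff_map_eq_zero]
  intro g hg
  by_contra hg0
  have := hbt.isAlgebraic
  obtain ⟨r, hr, hd⟩ := (Algebra.IsAlgebraic.isAlgebraic (R := adjoin k (Set.range b))
    g).exists_nonzero_dvd (mem_nonZeroDivisors_of_ne_zero hg0)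
  obtain ⟨t, ht⟩ := hd
  obtain ⟨P, hP⟩ : ∃ P, aeval b P = (r : B) := by
    have h : (r : B) ∈ adjoin k (Set.range b) := r.2
    generalize (r : B) = r' at h ⊢
    rwa [adjoin_range_eq_range_aeval] at h
  have h1 : f (aeval b P) = 0 := by
    rw [hP, show (r : B) = g * t from ht, map_mul, hg, zero_mul]
  rw [comp_aeval_apply] at h1
  have h2 : P = 0 := by
    refine hs.1.eq_zero_of_aeval_eq_zero P ?_
    rw [← h1]
    congr 2
    exact (funext hb).symm
  rw [h2, map_zero] at hP
  exact hr (Subtype.ext hP.symm)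

theorem trdeg_quotient_span_lt {k σ : Type} [Field k] [Finite σ] {F : MvPolynomial σ k}
    (hF : Irreducible F) : trdeg k (MvPolynomial σ k ⧸ Ideal.span {F}) < #σ := by
  have : (Ideal.span {F}).IsPrime := (Ideal.span_singleton_prime hF.ne_zero).2 hF.prime
  have ht : trdeg k (MvPolynomial σ k) = #σ := by simp [trdeg_of_isDomain]
  rw [← ht]
  refine trdeg_lt_of_surjective_of_not_injective (Ideal.Quotient.mkₐ k _)
    (Ideal.Quotient.mkₐ_surjective k _) (fun h => hF.ne_zero (h ?_)) ?_
  · rw [map_zero]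
    exact Ideal.Quotient.eq_zero_iff_mem.2 (Ideal.mem_span_singleton_self F)
  · rw [ht]
    exact Cardinal.lt_aleph0_of_finite σ

/-- If the image of a polynomial ring in `n` variables has transcendence degree at least `n - 1`,
then the kernel is generated by any irreducible polynomial in it. -/
theorem ker_eq_span_of_irreducible {k σ S : Type} [Field k] [Finite σ] [CommRing S] [IsDomain S]
    [Algebra k S] (f : MvPolynomial σ k →ₐ[k] S) {F : MvPolynomial σ k} (hF : Irreducible F)
    (hfF : f F = 0) (ht : #σ ≤ trdeg k f.range + 1) :
    RingHom.ker f = Ideal.span {F} := by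
  have : (Ideal.span {F}).IsPrime := (Ideal.span_singleton_prime hF.ne_zero).2 hF.prime
  have hle : Ideal.span {F} ≤ RingHom.ker f := by
    rw [Ideal.span_singleton_le_iff_mem]
    exact hfF
  refine le_antisymm ?_ hle
  let g : (MvPolynomial σ k ⧸ Ideal.span {F}) →ₐ[k] f.range :=
    Ideal.Quotient.liftₐ _ f.rangeRestrict fun x hx => Subtype.ext (hle hx)
  have hg : Function.Surjective g := by
    rintro ⟨_, x, rfl⟩
    exact ⟨Ideal.Quotient.mk _ x, rfl⟩
  have hlt := trdeg_quotient_span_lt hF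
  have hfin : trdeg k (MvPolynomial σ k ⧸ Ideal.span {F}) < ℵ₀ :=
    hlt.trans (Cardinal.lt_aleph0_of_finite σ)
  have hinj : Function.Injective g := by
    -- The quotient by `F` already has degree below `n`; a second proper quotient would push the
    -- degree of the range below `n - 1`.
    by_contra hn
    have h1 := trdeg_lt_of_surjective_of_not_injective g hg hn hfin
    exact absurd (ht.trans (Cardinal.add_one_le_of_lt h1)) (not_le.2 hlt)
  intro x hx
  rw [← Ideal.Quotient.eq_zero_iff_mem]
  refine hinj ?_
  rw [map_zero]
  exact Subtype.ext hx

theorem exists_irreducible_ker_eq_span {k σ S : Type} [Field k] [Finite σ] [CommRing S]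
    [IsDomain S] [Algebra k S] (f : MvPolynomial σ k →ₐ[k] S) (hf : ¬ Function.Injective f)
    (ht : #σ ≤ trdeg k f.range + 1) :
    ∃ F, Irreducible F ∧ RingHom.ker f = Ideal.span {F} := by
  have hp : (RingHom.ker f).IsPrime := RingHom.ker_isPrime _
  have hb : RingHom.ker f ≠ ⊥ := fun h => hf ((RingHom.injective_iff_ker_eq_bot _).2 h)
  obtain ⟨F, hF, hFp⟩ := Ideal.IsPrime.exists_mem_prime_of_ne_bot hp hb
  exact ⟨F, hFp.irreducible, ker_eq_span_of_irreducible f hFp.irreducible hF ht⟩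

end Trdeg

noncomputable section

namespace CPFive

open MvPolynomial

/-! ### Irreducibility of the binomial. -/

theorem isRelPrime_X {σ : Type} {i j : σ} (h : i ≠ j) :
    IsRelPrime (X i : MvPolynomial σ ℝ) (X j) := by
  refine (X_prime.irreducible.isRelPrime_iff_not_dvd).2 fun hd => ?_
  rw [X_dvd_X] at hd
  exact h hd

theorem notMem_vars_mul {σ : Type} {i : σ} {p q : MvPolynomial σ ℝ} (hp : i ∉ p.vars)
    (hq : i ∉ q.vars) : i ∉ (p * q).vars := by
  classical
  intro h
  exact (Finset.mem_union.1 (vars_mul p q h)).elim hp hq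

theorem notMem_vars_X {σ : Type} {i j : σ} (h : i ≠ j) : i ∉ (X j : MvPolynomial σ ℝ).vars := by
  rw [vars_X, Finset.mem_singleton]
  exact h

/-- The binomial is linear in `y₁₁`, and its two coefficients are monomials in disjoint sets of
variables, hence relatively prime. -/
theorem irreducible_hildBinomial : Irreducible hildBinomial := by
  have h := irreducible_mul_X_add (R := ℝ) (n := WIndex)
    (X (ix 1 1) * X (ix 2 2) * X (ix 3 3) * X (ix 4 4))
    (-(X (ix 0 2) * X (ix 1 3) * X (ix 2 4) * X (ix 3 0) * X (ix 4 1))) (ix 0 0)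
    ?_ ?_ ?_ ?_
  · convert h using 1
    rw [hildBinomial]
    ring
  · simp [X_ne_zero]
  · refine notMem_vars_mul (notMem_vars_mul (notMem_vars_mul ?_ ?_) ?_) ?_ <;>
      exact notMem_vars_X (by decide)
  · rw [vars_neg]
    refine notMem_vars_mul (notMem_vars_mul (notMem_vars_mul (notMem_vars_mul ?_ ?_) ?_) ?_) ?_ <;>
      exact notMem_vars_X (by decide)
  · rw [IsRelPrime.neg_right_iff]
    have key (j : WIndex) (h1 : ix 1 1 ≠ j) (h2 : ix 2 2 ≠ j) (h3 : ix 3 3 ≠ j)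
        (h4 : ix 4 4 ≠ j) : IsRelPrime (X (ix 1 1) * X (ix 2 2) * X (ix 3 3) * X (ix 4 4) :
          MvPolynomial WIndex ℝ) (X j) :=
      ((((isRelPrime_X h1).mul_left (isRelPrime_X h2)).mul_left (isRelPrime_X h3)).mul_left
        (isRelPrime_X h4))
    refine ((((key _ ?_ ?_ ?_ ?_).mul_right (key _ ?_ ?_ ?_ ?_)).mul_right
      (key _ ?_ ?_ ?_ ?_)).mul_right (key _ ?_ ?_ ?_ ?_)).mul_right (key _ ?_ ?_ ?_ ?_) <;> decide

/-! ### The comorphisms of `φ` and of the parametrization. -/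

/-- The matrix of coordinate functions on `W`. -/
def genericW : Matrix (Fin 5) (Fin 5) (MvPolynomial WIndex ℝ) :=
  !![X (ix 0 0), 0, 0, X (ix 3 0), X (ix 4 0);
     X (ix 0 1), X (ix 1 1), 0, 0, X (ix 4 1);
     X (ix 0 2), X (ix 1 2), X (ix 2 2), 0, 0;
     0, X (ix 1 3), X (ix 2 3), X (ix 3 3), 0;
     0, 0, X (ix 2 4), X (ix 3 4), X (ix 4 4)]

/-- The comorphism of `phi`. -/
def phiPullback : MvPolynomial SymIndex ℝ →ₐ[ℝ] MvPolynomial WIndex ℝ :=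
  aeval fun p => (genericW * genericWᵀ) p.1.1 p.1.2

theorem genericW_map_aeval {S : Type*} [CommRing S] [Algebra ℝ S] (y : WIndex → S) :
    genericW.map (aeval y) =
      !![y (ix 0 0), 0, 0, y (ix 3 0), y (ix 4 0);
         y (ix 0 1), y (ix 1 1), 0, 0, y (ix 4 1);
         y (ix 0 2), y (ix 1 2), y (ix 2 2), 0, 0;
         0, y (ix 1 3), y (ix 2 3), y (ix 3 3), 0;
         0, 0, y (ix 2 4), y (ix 3 4), y (ix 4 4)] := by
  ext i j
  fin_cases i <;> fin_cases j <;> simp [genericW]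

theorem aeval_phiPullback (y : WIndex → ℝ) (G : MvPolynomial SymIndex ℝ) :
    aeval y (phiPullback G) = aeval (symCoord (phi y)) G := by
  rw [phiPullback, comp_aeval_apply]
  congr 2
  funext p
  have h : (genericW * genericWᵀ).map (aeval y) = phi y := by
    rw [Matrix.map_mul, Matrix.transpose_map, genericW_map_aeval]
    rfl
  exact congrFun (congrFun h p.1.1) p.1.2

/-- Parameters of a rational parametrization of `hildFactors`: row scalings `(0, k)`, column
scalings `(1, k)`, and `(2, k)` for `tan (π / 4 - θₖ / 2)`. -/
abbrev Param : Type := Fin 3 × Fin 5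

/-- The factor of the coordinate `y_{jk}` that depends on the angles only. -/
def angleFactor {S : Type*} [CommRing S] (u : Fin 5 → S) (j k : Fin 5) : S :=
  if k = j then (1 - u (j + 4) ^ 2) * (1 + u (j + 3) ^ 2)
  else if k = j + 1 then 2 * (u (j + 4) + u (j + 3)) * (1 - u (j + 4) * u (j + 3))
  else (1 + u (j + 4) ^ 2) * (1 - u (j + 3) ^ 2)

/-- The parametrization of `hildFactors`. -/
def factorParam {S : Type*} [CommRing S] (x : Param → S) : WIndex → S :=
  fun p => x (0, p.1.2) * x (1, p.1.1) * angleFactor (fun i => x (2, i)) p.1.1 p.1.2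

/-- The comorphism of the parametrization of `hildFactors`. -/
def paramPullback : MvPolynomial WIndex ℝ →ₐ[ℝ] MvPolynomial Param ℝ :=
  aeval (factorParam X)

theorem map_factorParam {S T : Type*} [CommRing S] [CommRing T] (f : S →+* T) (x : Param → S)
    (p : WIndex) : f (factorParam x p) = factorParam (fun i => f (x i)) p := by
  simp only [factorParam, angleFactor]
  split_ifs <;> simp [map_ofNat f 2]

theorem aeval_paramPullback (x : Param → ℝ) (G : MvPolynomial WIndex ℝ) :
    aeval x (paramPullback G) = aeval (factorParam x) G := by
  rw [paramPullback, comp_aeval_apply]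
  congr 2
  funext p
  have := map_factorParam (aeval x : MvPolynomial Param ℝ →ₐ[ℝ] ℝ).toRingHom X p
  simpa using this

theorem paramPullback_hildBinomial : paramPullback hildBinomial = 0 := by
  simp only [paramPullback, hildBinomial, map_sub, map_mul, aeval_X, factorParam, angleFactor, ix]
  simp
  ring

/-! ### The Jacobian at a base point. -/

/-- The base point `θ = (π / 2, …, π / 2)` with trivial scalings. -/
def basePoint : Param → ℝ := fun p => if p.1 = 2 then 0 else 1

/-- The entries of the parametrized matrix at the base point. -/
def baseEntry (p : WIndex) : ℝ := if p.1.2 = p.1.1 + 1 then 0 else 1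

/-- The derivatives of the entries of the parametrized matrix at the base point. -/
def baseDeriv (j : Param) (p : WIndex) : ℝ :=
  if j.1 = 0 then if p.1.2 = j.2 then baseEntry p else 0
  else if j.1 = 1 then if p.1.1 = j.2 then baseEntry p else 0
  else if p.1.2 = p.1.1 + 1 then
    2 * ((if p.1.1 + 4 = j.2 then 1 else 0) + (if p.1.1 + 3 = j.2 then 1 else 0))
  else 0

theorem aeval_basePoint_factorParam (p : WIndex) :
    aeval basePoint (factorParam (X : Param → MvPolynomial Param ℝ) p) = baseEntry p := by
  obtain ⟨⟨j, k⟩, h⟩ := p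
  simp only [factorParam, angleFactor, baseEntry]
  rcases h with h | h | h <;> dsimp only at h <;> subst h <;> simp [basePoint]

theorem aeval_basePoint_pderiv_factorParam (j : Param) (p : WIndex) :
    aeval basePoint (pderiv j (factorParam (X : Param → MvPolynomial Param ℝ) p)) =
      baseDeriv j p := by
  obtain ⟨⟨c, k⟩, h⟩ := p
  obtain ⟨a, b⟩ := j
  simp only [factorParam, angleFactor, baseDeriv, baseEntry]
  rcases h with h | h | h <;> dsimp only at h <;> subst h <;> fin_cases a <;>
    simp [basePoint, pderiv_X, Pi.single_apply, Prod.ext_iff, apply_ite (eval basePoint)]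

/-- Fourteen of the entries of the parametrized `X Xᵀ`, together with one row scaling. -/
def parametrizedCoord (p : SymIndex) : MvPolynomial Param ℝ :=
  if p.1 = (0, 0) then X (0, 0) else paramPullback (phiPullback (X p))

theorem sum_symIndex (f : SymIndex → ℝ) : ∑ p, f p =
    f ⟨(0, 0), by decide⟩ + f ⟨(0, 1), by decide⟩ + f ⟨(0, 2), by decide⟩ +
    f ⟨(0, 3), by decide⟩ + f ⟨(0, 4), by decide⟩ + f ⟨(1, 1), by decide⟩ +
    f ⟨(1, 2), by decide⟩ + f ⟨(1, 3), by decide⟩ + f ⟨(1, 4), by decide⟩ +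
    f ⟨(2, 2), by decide⟩ + f ⟨(2, 3), by decide⟩ + f ⟨(2, 4), by decide⟩ +
    f ⟨(3, 3), by decide⟩ + f ⟨(3, 4), by decide⟩ + f ⟨(4, 4), by decide⟩ := by
  have h : (Finset.univ : Finset SymIndex) =
    {⟨(0, 0), by decide⟩, ⟨(0, 1), by decide⟩, ⟨(0, 2), by decide⟩, ⟨(0, 3), by decide⟩,
     ⟨(0, 4), by decide⟩, ⟨(1, 1), by decide⟩, ⟨(1, 2), by decide⟩, ⟨(1, 3), by decide⟩,
     ⟨(1, 4), by decide⟩, ⟨(2, 2), by decide⟩, ⟨(2, 3), by decide⟩, ⟨(2, 4), by decide⟩,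
     ⟨(3, 3), by decide⟩, ⟨(3, 4), by decide⟩, ⟨(4, 4), by decide⟩} := by decide
  rw [h]
  repeat rw [Finset.sum_insert (by decide)]
  rw [Finset.sum_singleton]
  ring

theorem paramPullback_phiPullback_X (p : SymIndex) :
    paramPullback (phiPullback (X p)) =
      (genericW.map paramPullback * (genericW.map paramPullback)ᵀ) p.1.1 p.1.2 := by
  rw [phiPullback, aeval_X, ← Matrix.transpose_map, ← Matrix.map_mul]
  rfl

/-- The value at the base point of the parametrized matrix. -/
def baseMatrix : Matrix (Fin 5) (Fin 5) ℝ :=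
  !![1, 0, 0, 1, 0; 0, 1, 0, 0, 1; 1, 0, 1, 0, 0; 0, 1, 0, 1, 0; 0, 0, 1, 0, 1]

theorem aeval_genericW (i l : Fin 5) :
    aeval basePoint (genericW.map paramPullback i l) = baseMatrix i l := by
  rw [paramPullback, genericW_map_aeval]
  fin_cases i <;> fin_cases l <;>
    simp [baseMatrix, aeval_basePoint_factorParam, baseEntry, ix]

theorem aeval_pderiv_genericW (j : Param) (i l : Fin 5) :
    aeval basePoint (pderiv j (genericW.map paramPullback i l)) = wMatrix (baseDeriv j) i l := by
  rw [paramPullback, genericW_map_aeval]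
  fin_cases i <;> fin_cases l <;>
    simp [wMatrix, aeval_basePoint_pderiv_factorParam]

theorem aeval_pderiv_parametrizedCoord (j : Param) (p : SymIndex) :
    aeval basePoint (pderiv j (parametrizedCoord p)) =
      if p.1 = (0, 0) then if j = (0, 0) then 1 else 0
      else ∑ l, (baseMatrix p.1.1 l * wMatrix (baseDeriv j) p.1.2 l +
        baseMatrix p.1.2 l * wMatrix (baseDeriv j) p.1.1 l) := by
  rw [parametrizedCoord]
  split_ifs with h h'
  · rw [h']; simp
  · rw [pderiv_X_of_ne (Ne.symm h')]; simp
  · rw [paramPullback_phiPullback_X, Matrix.mul_apply]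
    simp only [map_sum, Derivation.leibniz, smul_eq_mul, map_add, map_mul, Matrix.transpose_apply,
      aeval_genericW, aeval_pderiv_genericW]

/-- The base point violates `∑ θᵢ < π`, which is harmless for a statement about polynomials. There
the angle derivatives of all entries but the middle ones `y_{j,j+1}` vanish, so the linear system is
sparse. The row scaling in place of entry `(0, 0)` makes the Jacobian square; the 15 entries
themselves are dependent. -/
theorem algebraicIndependent_parametrizedCoord :
    AlgebraicIndependent ℝ parametrizedCoord := by
  let e : SymIndex ≃ Param := Fintype.equivOfCardEq (by decide)
  refine algebraicIndependent_of_jacobian (fun i => pderiv (e i)) _ (aeval basePoint) fun v hv => ?_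
  have hv' : ∀ j : Param, ∑ i, aeval basePoint (pderiv j (parametrizedCoord i)) * v i = 0 := by
    intro j
    simpa using hv (e.symm j)
  simp only [aeval_pderiv_parametrizedCoord, sum_symIndex, Fin.sum_univ_five] at hv'
  have h00 := hv' (0, 0)
  have h01 := hv' (0, 1)
  have h02 := hv' (0, 2)
  have h03 := hv' (0, 3)
  have h04 := hv' (0, 4)
  have h10 := hv' (1, 0)
  have h11 := hv' (1, 1)
  have h12 := hv' (1, 2)
  have h13 := hv' (1, 3)
  have h14 := hv' (1, 4)
  have h20 := hv' (2, 0)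
  have h21 := hv' (2, 1)
  have h22 := hv' (2, 2)
  have h23 := hv' (2, 3)
  have h24 := hv' (2, 4)
  clear hv hv'
  simp [baseMatrix, wMatrix, baseDeriv, baseEntry, ix]
    at h00 h01 h02 h03 h04 h10 h11 h12 h13 h14 h20 h21 h22 h23 h24
  funext p
  obtain ⟨⟨i, j⟩, hij⟩ := p
  fin_cases i <;> fin_cases j <;> first
    | exact absurd hij (by decide)
    | (simp only [Fin.zero_eta, Fin.mk_one, Fin.reduceFinMk, Pi.zero_apply]; linarith)

/-! ### Half-angle coordinates on the matrices `D₁ S(Θ) D₂`. -/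

theorem wMatrix_apply (y : WIndex → ℝ) (p : WIndex) : wMatrix y p.1.2 p.1.1 = y p := by
  obtain ⟨⟨j, k⟩, h⟩ := p
  fin_cases j <;> fin_cases k <;> first
    | rfl
    | exact absurd h (by decide)

theorem wMatrix_eq_iff {y : WIndex → ℝ} {θ d₁ d₂ : Fin 5 → ℝ} :
    wMatrix y = Matrix.diagonal d₁ * hildS θ * Matrix.diagonal d₂ ↔
      ∀ p, y p = d₁ p.1.2 * hildS θ p.1.2 p.1.1 * d₂ p.1.1 := by
  constructor
  · intro h p
    rw [← wMatrix_apply y p, h, Matrix.mul_diagonal, Matrix.diagonal_mul]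
  · intro h
    ext i j
    rw [Matrix.mul_diagonal, Matrix.diagonal_mul]
    fin_cases i <;> fin_cases j <;> first
      | simp [wMatrix, hildS]; done
      | exact h (ix _ _)

/-- The half-angle coordinate `tan (π / 4 - θ / 2)`. -/
def halfAngle (t : ℝ) : ℝ := Real.tan (Real.pi / 4 - t / 2)

theorem cos_quarter_sub_pos {t : ℝ} (h0 : 0 < t) (h1 : t < Real.pi) :
    0 < Real.cos (Real.pi / 4 - t / 2) :=
  Real.cos_pos_of_mem_Ioo ⟨by linarith, by linarith⟩

theorem one_sub_halfAngle_sq {t : ℝ} (h0 : 0 < t) (h1 : t < Real.pi) :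
    1 - halfAngle t ^ 2 = Real.sin t * (1 + halfAngle t ^ 2) := by
  have hc := (cos_quarter_sub_pos h0 h1).ne'
  have hs : Real.sin t = Real.cos (2 * (Real.pi / 4 - t / 2)) := by
    rw [← Real.cos_pi_div_two_sub]
    congr 1
    ring
  rw [halfAngle, hs, Real.cos_two_mul', Real.tan_eq_sin_div_cos]
  generalize Real.pi / 4 - t / 2 = x at *
  field_simp
  linear_combination (Real.sin x ^ 2 - Real.cos x ^ 2) * Real.sin_sq_add_cos_sq x

theorem two_mul_halfAngle {t : ℝ} (h0 : 0 < t) (h1 : t < Real.pi) :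
    2 * halfAngle t = Real.cos t * (1 + halfAngle t ^ 2) := by
  have hc := (cos_quarter_sub_pos h0 h1).ne'
  have hs : Real.cos t = Real.sin (2 * (Real.pi / 4 - t / 2)) := by
    rw [← Real.sin_pi_div_two_sub]
    congr 1
    ring
  rw [halfAngle, hs, Real.sin_two_mul, Real.tan_eq_sin_div_cos]
  generalize Real.pi / 4 - t / 2 = x at *
  have h1 : 1 + (Real.sin x / Real.cos x) ^ 2 = 1 / Real.cos x ^ 2 := by
    field_simp
    exact Real.cos_sq_add_sin_sq x
  rw [h1]
  field_simp

theorem injOn_halfAngle : Set.InjOn halfAngle (Set.Ioo 0 Real.pi) := by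
  intro s hs t ht h
  have h1 := two_mul_halfAngle hs.1 hs.2
  rw [h, two_mul_halfAngle ht.1 ht.2] at h1
  exact (Real.injOn_cos ⟨ht.1.le, ht.2.le⟩ ⟨hs.1.le, hs.2.le⟩
    (mul_right_cancel₀ (by positivity) h1)).symm

theorem angle_lt_pi {θ : Fin 5 → ℝ} (hθ : θ ∈ angles) (i : Fin 5) : θ i < Real.pi :=
  (Finset.single_le_sum (fun j _ => (hθ.1 j).le) (Finset.mem_univ i)).trans_lt hθ.2

/-- Denominators are cleared in `sin t = (1 - u²) / (1 + u²)` and `cos t = 2u / (1 + u²)`. The extra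
factor depends only on the column, so a column scaling absorbs it. -/
theorem angleFactor_halfAngle {θ : Fin 5 → ℝ} (hθ : θ ∈ angles) (p : WIndex) :
    angleFactor (fun i => halfAngle (θ i)) p.1.1 p.1.2 =
      hildS θ p.1.2 p.1.1 *
        ((1 + halfAngle (θ (p.1.1 + 4)) ^ 2) * (1 + halfAngle (θ (p.1.1 + 3)) ^ 2)) := by
  obtain ⟨⟨j, k⟩, h⟩ := p
  have s4 := one_sub_halfAngle_sq (hθ.1 (j + 4)) (angle_lt_pi hθ (j + 4))
  have s3 := one_sub_halfAngle_sq (hθ.1 (j + 3)) (angle_lt_pi hθ (j + 3))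
  have c4 := two_mul_halfAngle (hθ.1 (j + 4)) (angle_lt_pi hθ (j + 4))
  have c3 := two_mul_halfAngle (hθ.1 (j + 3)) (angle_lt_pi hθ (j + 3))
  rcases h with h | h | h <;> dsimp only at h <;> subst h <;> dsimp only
  · have hS : hildS θ k k = Real.sin (θ (k + 4)) := by fin_cases k <;> rfl
    rw [hS]
    simp only [angleFactor, if_true]
    linear_combination (1 + halfAngle (θ (k + 3)) ^ 2) * s4
  · have hS : hildS θ (j + 1) j = Real.sin (θ (j + 4) + θ (j + 3)) := by
      rw [add_comm (θ (j + 4))]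
      fin_cases j <;> first | rfl | (exact congrArg Real.sin (add_comm _ _))
    rw [hS, Real.sin_add]
    simp only [angleFactor, if_true, if_neg (show ¬(j + 1 = j) by simp)]
    generalize halfAngle (θ (j + 4)) = u at *
    generalize halfAngle (θ (j + 3)) = v at *
    linear_combination (1 - v ^ 2) * c4 + Real.cos (θ (j + 4)) * (1 + u ^ 2) * s3 +
      (1 - u ^ 2) * c3 + Real.cos (θ (j + 3)) * (1 + v ^ 2) * s4
  · have hS : hildS θ (j + 2) j = Real.sin (θ (j + 3)) := by fin_cases j <;> rfl
    rw [hS]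
    simp only [angleFactor, if_neg (show ¬(j + 2 = j) by simp),
      if_neg (show ¬(j + 2 = j + 1) by simp)]
    linear_combination (1 + halfAngle (θ (j + 4)) ^ 2) * s3

theorem factorParam_mem_hildFactors {θ : Fin 5 → ℝ} (hθ : θ ∈ angles) {x : Param → ℝ}
    (h0 : ∀ i, 0 < x (0, i)) (h1 : ∀ i, 0 < x (1, i)) (h2 : ∀ i, x (2, i) = halfAngle (θ i)) :
    factorParam x ∈ hildFactors := by
  refine ⟨θ, hθ, fun i => x (0, i), fun j => x (1, j) *
    ((1 + halfAngle (θ (j + 4)) ^ 2) * (1 + halfAngle (θ (j + 3)) ^ 2)), h0, fun j => ?_,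
    wMatrix_eq_iff.2 fun p => ?_⟩
  · have := h1 j
    positivity
  · simp only [factorParam, h2, angleFactor_halfAngle hθ]
    ring

theorem exists_factorParam_eq {y : WIndex → ℝ} (hy : y ∈ hildFactors) :
    ∃ x, factorParam x = y := by
  obtain ⟨θ, hθ, d₁, d₂, -, -, h⟩ := hy
  rw [wMatrix_eq_iff] at h
  refine ⟨fun p => if p.1 = 0 then d₁ p.2 else if p.1 = 1 then d₂ p.2 /
    ((1 + halfAngle (θ (p.2 + 4)) ^ 2) * (1 + halfAngle (θ (p.2 + 3)) ^ 2))
    else halfAngle (θ p.2), ?_⟩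
  funext p
  have := angleFactor_halfAngle hθ p
  simp only [factorParam, h p]
  simp [this]
  field_simp

/-! ### Vanishing ideals and Zariski closures. -/

theorem vanishingIdeal_hildFactors :
    vanishingIdeal ℝ hildFactors = RingHom.ker paramPullback := by
  ext G
  rw [mem_vanishingIdeal_iff, RingHom.mem_ker]
  constructor
  · intro hG
    -- A polynomial vanishing on a product of infinite sets is zero. Bounding each angle by `π / 5`
    -- makes the admissible parameters contain such a product.
    let s : Param → Set ℝ := fun p =>
      if p.1 = 2 then halfAngle '' Set.Ioo 0 (Real.pi / 5) else Set.Ioi 0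
    have hpi := Real.pi_pos
    refine funext_set s (fun p => ?_) fun x hx => ?_
    · dsimp only [s]
      split_ifs
      · exact (Set.Ioo_infinite (by positivity)).image
          (injOn_halfAngle.mono (Set.Ioo_subset_Ioo_right (by linarith)))
      · exact Set.Ioi_infinite 0
    · have h2 : ∀ i, ∃ t, t ∈ Set.Ioo 0 (Real.pi / 5) ∧ halfAngle t = x (2, i) :=
        fun i => hx (2, i) trivial
      choose θ hθ hθx using h2
      have hθa : θ ∈ angles := by
        refine ⟨fun i => (hθ i).1, ?_⟩
        calc ∑ i, θ i < ∑ _i : Fin 5, Real.pi / 5 :=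
              Finset.sum_lt_sum_of_nonempty Finset.univ_nonempty fun i _ => (hθ i).2
          _ = Real.pi := by simp; ring
      have := hG _ (factorParam_mem_hildFactors (x := x) hθa (fun i => hx (0, i) trivial)
        (fun i => hx (1, i) trivial) (fun i => (hθx i).symm))
      rw [← aeval_paramPullback] at this
      rw [map_zero]
      exact this
  · intro hG y hy
    obtain ⟨x, rfl⟩ := exists_factorParam_eq hy
    rw [← aeval_paramPullback, hG, map_zero]

theorem mem_vanishingIdeal_phi_image {S : Set (WIndex → ℝ)} {G : MvPolynomial SymIndex ℝ} :
    G ∈ vanishingIdeal ℝ (symCoord '' (phi '' S)) ↔ phiPullback G ∈ vanishingIdeal ℝ S := by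
  simp only [mem_vanishingIdeal_iff, Set.forall_mem_image, aeval_phiPullback]

theorem vanishingIdeal_phi_hildFactors :
    vanishingIdeal ℝ (symCoord '' (phi '' hildFactors)) =
      RingHom.ker (paramPullback.comp phiPullback) := by
  ext G
  rw [mem_vanishingIdeal_phi_image, vanishingIdeal_hildFactors]
  rfl

open Cardinal Algebra

theorem mk_symIndex_le_trdeg_range :
    #SymIndex ≤ trdeg ℝ (paramPullback.comp phiPullback).range + 1 := by
  let x : {p : SymIndex // p.1 ≠ (0, 0)} → (paramPullback.comp phiPullback).range :=
    fun p => ⟨paramPullback (phiPullback (X p.1)), X p.1, rfl⟩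
  have hx : AlgebraicIndependent ℝ x := by
    refine AlgebraicIndependent.of_comp (paramPullback.comp phiPullback).range.val ?_
    convert algebraicIndependent_parametrizedCoord.comp
      (Subtype.val : {p : SymIndex // p.1 ≠ (0, 0)} → SymIndex) Subtype.val_injective using 1
    funext p
    exact (if_neg p.2).symm
  have h := hx.cardinalMk_le_trdeg
  have hc : #SymIndex = #{p : SymIndex // p.1 ≠ (0, 0)} + 1 := by
    rw [mk_fintype, mk_fintype, show Fintype.card SymIndex =
      Fintype.card {p : SymIndex // p.1 ≠ (0, 0)} + 1 by decide]
    norm_cast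
  rw [hc]
  gcongr

theorem mk_wIndex_le_trdeg_range : #WIndex ≤ trdeg ℝ paramPullback.range + 1 := by
  have h1 : #WIndex = #SymIndex := by
    rw [mk_fintype, mk_fintype, show Fintype.card WIndex = Fintype.card SymIndex by decide]
  rw [h1]
  refine mk_symIndex_le_trdeg_range.trans ?_
  gcongr
  exact trdeg_le_of_injective (Subalgebra.inclusion (AlgHom.range_comp_le_range _ _))
    (Subalgebra.inclusion_injective _)

theorem ker_paramPullback : RingHom.ker paramPullback = Ideal.span {hildBinomial} :=
  ker_eq_span_of_irreducible _ irreducible_hildBinomial paramPullback_hildBinomial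
    mk_wIndex_le_trdeg_range

/-- The composite factors through the range of `paramPullback`, whose transcendence degree is below
15 because the binomial is killed, while the source has degree 15. -/
theorem not_injective_comp : ¬ Function.Injective (paramPullback.comp phiPullback) := by
  intro hi
  have hW : trdeg ℝ (MvPolynomial WIndex ℝ) = #WIndex := by simp [trdeg_of_isDomain]
  have hS : trdeg ℝ (MvPolynomial SymIndex ℝ) = #SymIndex := by simp [trdeg_of_isDomain]
  have h1 : trdeg ℝ paramPullback.range < trdeg ℝ (MvPolynomial WIndex ℝ) := by
    refine trdeg_lt_of_surjective_of_not_injective paramPullback.rangeRestrict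
      paramPullback.rangeRestrict_surjective (fun h => irreducible_hildBinomial.ne_zero (h ?_)) ?_
    · rw [map_zero]
      exact Subtype.ext paramPullback_hildBinomial
    · rw [hW]
      exact Cardinal.lt_aleph0_of_finite _
  have h2 : trdeg ℝ (MvPolynomial SymIndex ℝ) ≤ trdeg ℝ paramPullback.range :=
    trdeg_le_of_injective (paramPullback.rangeRestrict.comp phiPullback) fun a b hab =>
      hi (congrArg Subtype.val hab)
  rw [hW] at h1
  rw [hS] at h2
  have h3 : #WIndex = #SymIndex := by
    rw [mk_fintype, mk_fintype, show Fintype.card WIndex = Fintype.card SymIndex by decide]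
  exact absurd (h2.trans_lt h1) (by rw [h3]; exact lt_irrefl _)

theorem isZariskiHypersurface_phi_hildFactors :
    IsZariskiHypersurface (symCoord '' (phi '' hildFactors)) := by
  rw [IsZariskiHypersurface, vanishingIdeal_phi_hildFactors]
  exact exists_irreducible_ker_eq_span _ not_injective_comp mk_symIndex_le_trdeg_range

theorem vanishingIdeal_hildFactors_eq_span :
    vanishingIdeal ℝ hildFactors = Ideal.span {hildBinomial} := by
  rw [vanishingIdeal_hildFactors, ker_paramPullback]

theorem hildFactors_subset_hildZ : hildFactors ⊆ hildZ := by
  rw [hildZ, ← vanishingIdeal_hildFactors_eq_span]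
  exact zeroLocus_vanishingIdeal_le _

theorem vanishingIdeal_hildZ : vanishingIdeal ℝ hildZ = Ideal.span {hildBinomial} := by
  refine le_antisymm ?_ (le_vanishingIdeal_zeroLocus _)
  rw [← vanishingIdeal_hildFactors_eq_span]
  exact vanishingIdeal_anti_mono hildFactors_subset_hildZ

theorem zariskiClosure_hildFactors : zariskiClosure hildFactors = hildZ := by
  rw [zariskiClosure, vanishingIdeal_hildFactors_eq_span, hildZ]

/-- Every set between `hildFactors` and `hildZ` has the same image under `phi`, up to Zariski
closure. -/
theorem zariskiClosure_phi_image {S : Set (WIndex → ℝ)} (h₁ : hildFactors ⊆ S) (h₂ : S ⊆ hildZ) :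
    zariskiClosure (symCoord '' (phi '' hildFactors)) =
      zariskiClosure (symCoord '' (phi '' S)) := by
  -- The ideal of `S` is squeezed between those of `hildZ` and `hildFactors`, which coincide.
  have h : vanishingIdeal ℝ S = vanishingIdeal ℝ hildFactors := by
    refine le_antisymm (vanishingIdeal_anti_mono h₁) ?_
    rw [vanishingIdeal_hildFactors_eq_span, ← vanishingIdeal_hildZ]
    exact vanishingIdeal_anti_mono h₂
  rw [zariskiClosure, zariskiClosure]
  congr 1
  ext G
  rw [mem_vanishingIdeal_phi_image, mem_vanishingIdeal_phi_image, h]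

/-! ### Copositivity of the Hildebrand form. -/

open Real in
/-- The quadratic form of the Hildebrand matrix with angles `a, b, c, d, e`. -/
def hildForm (a b c d e x₀ x₁ x₂ x₃ x₄ : ℝ) : ℝ :=
  x₀ ^ 2 + x₁ ^ 2 + x₂ ^ 2 + x₃ ^ 2 + x₄ ^ 2 +
    2 * (cos (a + b) * (x₀ * x₂) + cos (b + c) * (x₁ * x₃) + cos (c + d) * (x₂ * x₄) +
      cos (d + e) * (x₃ * x₀) + cos (e + a) * (x₄ * x₁)) -
    2 * (cos a * (x₀ * x₁) + cos b * (x₁ * x₂) + cos c * (x₂ * x₃) + cos d * (x₃ * x₄) +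
      cos e * (x₄ * x₀))

theorem hildForm_rotate (a b c d e x₀ x₁ x₂ x₃ x₄ : ℝ) :
    hildForm b c d e a x₁ x₂ x₃ x₄ x₀ = hildForm a b c d e x₀ x₁ x₂ x₃ x₄ := by
  unfold hildForm
  ring

/-- The deviation of the Hildebrand matrix from a matrix of rank two: `cos x + cos (s - x)`. -/
def deviation (s x : ℝ) : ℝ := Real.cos x + Real.cos (s - x)

theorem deviation_pos {s x : ℝ} (h0 : 0 < x) (h1 : x < s) (h2 : s < Real.pi) :
    0 < deviation s x := by
  have := Real.cos_lt_cos_of_nonneg_of_le_pi (x := s - x) (y := Real.pi - x) (by linarith)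
    (by linarith) (by linarith)
  rw [Real.cos_pi_sub] at this
  rw [deviation]
  linarith

theorem deviation_eq (s x : ℝ) :
    deviation s x = 2 * Real.cos (s / 2) * Real.cos (s / 2 - x) := by
  have h1 : x = s / 2 - (s / 2 - x) := by ring
  have h2 : s - x = s / 2 + (s / 2 - x) := by ring
  rw [deviation, h2]
  nth_rw 1 [h1]
  rw [Real.cos_sub, Real.cos_add]
  ring

/-- After the common factor `(2 cos (s / 2))²` is removed from both products, their difference is
`sin y * sin (s - x - y - z)`. -/
theorem deviation_mul_lt {s x y z : ℝ} (hx : 0 < x) (hy : 0 < y) (hz : 0 < z) (h : x + y + z < s)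
    (hs : s < Real.pi) :
    deviation s x * deviation s z < deviation s (x + y) * deviation s (y + z) := by
  have h1 : 0 < Real.cos (s / 2) := Real.cos_pos_of_mem_Ioo ⟨by linarith, by linarith⟩
  have h2 : 0 < Real.sin y := Real.sin_pos_of_pos_of_lt_pi hy (by linarith)
  have h3 : 0 < Real.sin (s - x - y - z) :=
    Real.sin_pos_of_pos_of_lt_pi (by linarith) (by linarith)
  have key : Real.cos (s / 2 - (x + y)) * Real.cos (s / 2 - (y + z)) -
      Real.cos (s / 2 - x) * Real.cos (s / 2 - z) = Real.sin (s - x - y - z) * Real.sin y := by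
    have e1 : s / 2 - (x + y) = (s / 2 - x) - y := by ring
    have e2 : s / 2 - (y + z) = (s / 2 - z) - y := by ring
    have e3 : s - x - y - z = (s / 2 - x) + (s / 2 - z) - y := by ring
    rw [e1, e2, e3]
    generalize s / 2 - x = u
    generalize s / 2 - z = v
    simp only [Real.cos_sub, Real.sin_sub, Real.sin_add, Real.cos_add]
    linear_combination (Real.cos u * Real.cos v) * Real.sin_sq_add_cos_sq y
  have : 0 < (2 * Real.cos (s / 2)) ^ 2 * (Real.sin (s - x - y - z) * Real.sin y) := by positivity
  rw [← key] at this
  simp only [deviation_eq]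
  linarith

theorem cos_sub_eq {u v w : ℝ} (h : w = v - u) :
    Real.cos w = Real.cos u * Real.cos v + Real.sin u * Real.sin v := by
  rw [h, Real.cos_sub]
  ring

/-- The Hildebrand form is the sum of a form of rank two and three cross terms. -/
theorem hildForm_eq (a b c d e x₀ x₁ x₂ x₃ x₄ s : ℝ) (hs : a + b + c + d + e = s) :
    hildForm a b c d e x₀ x₁ x₂ x₃ x₄ =
      (x₀ - x₁ * Real.cos a + x₂ * Real.cos (a + b) - x₃ * Real.cos (a + b + c) +
        x₄ * Real.cos (a + b + c + d)) ^ 2 +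
      (-x₁ * Real.sin a + x₂ * Real.sin (a + b) - x₃ * Real.sin (a + b + c) +
        x₄ * Real.sin (a + b + c + d)) ^ 2 +
      2 * (x₀ * (deviation s (d + e) * x₃ - deviation s e * x₄) +
        deviation s (e + a) * (x₁ * x₄)) := by
  subst hs
  have h1 : a + b + c + d + e - (d + e) = a + b + c := by ring
  have h2 : a + b + c + d + e - e = a + b + c + d := by ring
  have h3 : a + b + c + d + e - (e + a) = b + c + d := by ring
  rw [hildForm, deviation, deviation, deviation, h1, h2, h3]
  -- The squares come from plane unit vectors with alternating signs at the partial sums of the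
  -- angles. Their Gram matrix agrees with `T` except at the pairs `(0, 3)`, `(0, 4)`, `(1, 4)`,
  -- which cross the point where the cycle is cut.
  rw [cos_sub_eq (show b = (a + b) - a by ring), cos_sub_eq (show b + c = (a + b + c) - a by ring),
    cos_sub_eq (show b + c + d = (a + b + c + d) - a by ring),
    cos_sub_eq (show c = (a + b + c) - (a + b) by ring),
    cos_sub_eq (show c + d = (a + b + c + d) - (a + b) by ring),
    cos_sub_eq (show d = (a + b + c + d) - (a + b + c) by ring)]
  have q1 := Real.sin_sq_add_cos_sq a
  have q2 := Real.sin_sq_add_cos_sq (a + b)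
  have q3 := Real.sin_sq_add_cos_sq (a + b + c)
  have q4 := Real.sin_sq_add_cos_sq (a + b + c + d)
  linear_combination -x₁ ^ 2 * q1 - x₂ ^ 2 * q2 - x₃ ^ 2 * q3 - x₄ ^ 2 * q4

/-- The cycle is cut before index 3 instead of index 0. In the two expansions `x₃` and `x₄` enter
the only bracket of indefinite sign with opposite signs, so one expansion can replace the other. -/
theorem hildForm_eq' (a b c d e x₀ x₁ x₂ x₃ x₄ s : ℝ) (hs : a + b + c + d + e = s) :
    hildForm a b c d e x₀ x₁ x₂ x₃ x₄ =
      (x₃ - x₄ * Real.cos d + x₀ * Real.cos (d + e) - x₁ * Real.cos (d + e + a) +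
        x₂ * Real.cos (d + e + a + b)) ^ 2 +
      (-x₄ * Real.sin d + x₀ * Real.sin (d + e) - x₁ * Real.sin (d + e + a) +
        x₂ * Real.sin (d + e + a + b)) ^ 2 +
      2 * (x₂ * (deviation s (c + d) * x₄ - deviation s c * x₃) +
        deviation s (b + c) * (x₁ * x₃)) := by
  rw [← hildForm_rotate, ← hildForm_rotate, ← hildForm_rotate, hildForm_eq d e a b c _ _ _ _ _ s
    (by rw [← hs]; ring)]
  ring

theorem hildForm_nonneg {a b c d e x₀ x₁ x₂ x₃ x₄ : ℝ} (ha : 0 < a) (hb : 0 < b) (hc : 0 < c)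
    (hd : 0 < d) (he : 0 < e) (hs : a + b + c + d + e < Real.pi) (h₀ : 0 ≤ x₀) (h₁ : 0 ≤ x₁)
    (h₂ : 0 ≤ x₂) (h₃ : 0 ≤ x₃) (h₄ : 0 ≤ x₄) : 0 ≤ hildForm a b c d e x₀ x₁ x₂ x₃ x₄ := by
  obtain ⟨s, hss⟩ : ∃ s, a + b + c + d + e = s := ⟨_, rfl⟩
  rw [hss] at hs
  have p1 := deviation_pos (s := s) (x := e + a) (by linarith) (by linarith) hs
  have p2 := deviation_pos (s := s) (x := b + c) (by linarith) (by linarith) hs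
  have p3 := deviation_pos (s := s) (x := c + d) (by linarith) (by linarith) hs
  have p4 := deviation_pos (s := s) (x := d + e) (by linarith) (by linarith) hs
  have p5 := deviation_pos (s := s) (x := c) (by linarith) (by linarith) hs
  have p6 := deviation_pos (s := s) (x := e) (by linarith) (by linarith) hs
  have key := deviation_mul_lt (s := s) hc hd he (by linarith) hs
  by_cases hL : deviation s e * x₄ ≤ deviation s (d + e) * x₃
  · rw [hildForm_eq a b c d e _ _ _ _ _ s hss]
    have : 0 ≤ deviation s (d + e) * x₃ - deviation s e * x₄ := by linarith
    positivity
  · rw [hildForm_eq' a b c d e _ _ _ _ _ s hss]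
    have : 0 ≤ deviation s (c + d) * x₄ - deviation s c * x₃ := by
      -- If both brackets were negative, eliminating `x₃` between them would contradict
      -- `deviation_mul_lt`.
      by_contra! hR
      push Not at hL
      have h4 : 0 < x₄ := by
        refine lt_of_le_of_ne h₄ fun h => ?_
        rw [← h, mul_zero] at hL
        exact absurd hL (not_lt.2 (by positivity))
      have e1 := mul_lt_mul_of_pos_left hL p5
      have e2 := mul_lt_mul_of_pos_left (sub_neg.1 hR) p4
      nlinarith [mul_lt_mul_of_pos_right key h4]
    positivity

/-! ### Zeros of the form in the nonnegative orthant. -/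

/-- With `x₃` and `x₄` positive, one of the two brackets is strictly positive, so both nonnegative
cross terms of that expansion must vanish. -/
theorem eq_zero_of_hildForm_eq_zero {a b c d e x₀ x₁ x₂ x₃ x₄ : ℝ} (ha : 0 < a) (hb : 0 < b)
    (hc : 0 < c) (hd : 0 < d) (he : 0 < e) (hs : a + b + c + d + e < Real.pi) (h₀ : 0 ≤ x₀)
    (h₁ : 0 ≤ x₁) (h₂ : 0 ≤ x₂) (h₃ : 0 < x₃) (h₄ : 0 < x₄)
    (h : hildForm a b c d e x₀ x₁ x₂ x₃ x₄ = 0) : x₁ = 0 ∧ (x₀ = 0 ∨ x₂ = 0) := by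
  obtain ⟨s, hss⟩ : ∃ s, a + b + c + d + e = s := ⟨_, rfl⟩
  rw [hss] at hs
  have p1 := deviation_pos (s := s) (x := e + a) (by linarith) (by linarith) hs
  have p2 := deviation_pos (s := s) (x := b + c) (by linarith) (by linarith) hs
  have p4 := deviation_pos (s := s) (x := d + e) (by linarith) (by linarith) hs
  have p5 := deviation_pos (s := s) (x := c) (by linarith) (by linarith) hs
  have key := deviation_mul_lt (s := s) hc hd he (by linarith) hs
  by_cases hL : deviation s e * x₄ < deviation s (d + e) * x₃
  · rw [hildForm_eq a b c d e _ _ _ _ _ s hss] at h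
    have hp : 0 < deviation s (d + e) * x₃ - deviation s e * x₄ := by linarith
    have t1 : 0 ≤ x₀ * (deviation s (d + e) * x₃ - deviation s e * x₄) := by positivity
    have t2 : 0 ≤ deviation s (e + a) * (x₁ * x₄) := by positivity
    have z1 : x₀ * (deviation s (d + e) * x₃ - deviation s e * x₄) = 0 := by
      refine le_antisymm ?_ t1
      nlinarith
    have z2 : deviation s (e + a) * (x₁ * x₄) = 0 := by
      refine le_antisymm ?_ t2
      nlinarith
    simp only [mul_eq_zero, p1.ne', hp.ne', h₄.ne', false_or, or_false] at z1 z2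
    exact ⟨z2, Or.inl z1⟩
  · rw [hildForm_eq' a b c d e _ _ _ _ _ s hss] at h
    have hp : 0 < deviation s (c + d) * x₄ - deviation s c * x₃ := by
      by_contra! hR
      push Not at hL
      have e1 := mul_le_mul_of_nonneg_left hL p5.le
      have e2 := mul_le_mul_of_nonneg_left (sub_nonpos.1 hR) p4.le
      nlinarith [mul_lt_mul_of_pos_right key h₄]
    have t1 : 0 ≤ x₂ * (deviation s (c + d) * x₄ - deviation s c * x₃) := by positivity
    have t2 : 0 ≤ deviation s (b + c) * (x₁ * x₃) := by positivity
    have z1 : x₂ * (deviation s (c + d) * x₄ - deviation s c * x₃) = 0 := by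
      refine le_antisymm ?_ t1
      nlinarith
    have z2 : deviation s (b + c) * (x₁ * x₃) = 0 := by
      refine le_antisymm ?_ t2
      nlinarith
    simp only [mul_eq_zero, p2.ne', hp.ne', h₃.ne', false_or, or_false] at z1 z2
    exact ⟨z2, Or.inr z1⟩

/-- Without `x₃` and `x₄` the cross terms disappear; the form is a sum of two squares, and their
vanishing is a linear system with a one-dimensional solution space. -/
theorem exists_eq_smul_of_hildForm_eq_zero {a b c d e x₀ x₁ x₂ : ℝ} (ha : 0 < a) (hb : 0 < b)
    (hab : a + b < Real.pi) (h₂ : 0 ≤ x₂) (h : hildForm a b c d e x₀ x₁ x₂ 0 0 = 0) :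
    ∃ t, 0 ≤ t ∧ x₀ = t * Real.sin b ∧ x₁ = t * Real.sin (a + b) ∧ x₂ = t * Real.sin a := by
  have hsa := Real.sin_pos_of_pos_of_lt_pi ha (by linarith)
  rw [hildForm_eq a b c d e _ _ _ _ _ _ rfl] at h
  simp only [zero_mul, mul_zero, add_zero, sub_zero] at h
  have z1 : x₀ - x₁ * Real.cos a + x₂ * Real.cos (a + b) = 0 := by nlinarith
  have z2 : -x₁ * Real.sin a + x₂ * Real.sin (a + b) = 0 := by nlinarith
  refine ⟨x₂ / Real.sin a, by positivity, ?_, ?_, by field_simp⟩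
  · field_simp
    have hb' : Real.sin b = Real.sin (a + b) * Real.cos a - Real.cos (a + b) * Real.sin a := by
      rw [← Real.sin_sub]
      congr 1
      ring
    rw [hb']
    linear_combination Real.sin a * z1 - Real.cos a * z2
  · field_simp
    linarith

/-- The Hildebrand form in the coordinates of `Fin 5 → ℝ`. -/
def hildQuad (θ x : Fin 5 → ℝ) : ℝ :=
  hildForm (θ 0) (θ 1) (θ 2) (θ 3) (θ 4) (x 0) (x 1) (x 2) (x 3) (x 4)

theorem dotProduct_hildT_mulVec (θ x : Fin 5 → ℝ) : x ⬝ᵥ (hildT θ *ᵥ x) = hildQuad θ x := by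
  simp only [dotProduct, Matrix.mulVec, Fin.sum_univ_five, hildT, hildQuad, hildForm]
  simp
  ring

theorem hildQuad_rotate_one (θ x : Fin 5 → ℝ) :
    hildQuad (fun i => θ (i + 1)) (fun i => x (i + 1)) = hildQuad θ x :=
  hildForm_rotate _ _ _ _ _ _ _ _ _ _

theorem hildQuad_rotate (θ x : Fin 5 → ℝ) (k : Fin 5) :
    hildQuad (fun i => θ (i + k)) (fun i => x (i + k)) = hildQuad θ x := by
  have step (k : Fin 5) : hildQuad (fun i => θ (i + (1 + k))) (fun i => x (i + (1 + k))) =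
      hildQuad (fun i => θ (i + k)) (fun i => x (i + k)) := by
    rw [← hildQuad_rotate_one (fun i => θ (i + k))]
    simp only [add_assoc]
  have h1 := step 0
  have h2 := step 1
  have h3 := step 2
  have h4 := step 3
  simp only [add_zero] at h1
  fin_cases k
  · simp
  · exact h1
  · exact h2.trans h1
  · exact h3.trans (h2.trans h1)
  · exact h4.trans (h3.trans (h2.trans h1))

theorem angles_rotate {θ : Fin 5 → ℝ} (hθ : θ ∈ angles) (k : Fin 5) :
    (fun i => θ (i + k)) ∈ angles := by
  exact ⟨fun i => hθ.1 _, (Equiv.sum_comp (Equiv.addRight k) θ).trans_lt hθ.2⟩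

theorem sum_lt_pi {θ : Fin 5 → ℝ} (hθ : θ ∈ angles) :
    θ 0 + θ 1 + θ 2 + θ 3 + θ 4 < Real.pi := by
  have := hθ.2
  rwa [Fin.sum_univ_five] at this

theorem hildQuad_nonneg {θ x : Fin 5 → ℝ} (hθ : θ ∈ angles) (hx : ∀ i, 0 ≤ x i) :
    0 ≤ hildQuad θ x :=
  hildForm_nonneg (hθ.1 0) (hθ.1 1) (hθ.1 2) (hθ.1 3) (hθ.1 4) (sum_lt_pi hθ) (hx 0) (hx 1)
    (hx 2) (hx 3) (hx 4)

/-- A nonnegative zero of a Hildebrand form is supported on three consecutive indices. -/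
theorem exists_zero_pair {θ x : Fin 5 → ℝ} (hθ : θ ∈ angles) (hx : ∀ i, 0 ≤ x i)
    (h : hildQuad θ x = 0) : ∃ k, x (3 + k) = 0 ∧ x (4 + k) = 0 := by
  have key (k : Fin 5) (h3 : 0 < x (3 + k)) (h4 : 0 < x (4 + k)) :
      x (1 + k) = 0 ∧ (x (0 + k) = 0 ∨ x (2 + k) = 0) := by
    have hθ' := angles_rotate hθ k
    rw [← hildQuad_rotate θ x k] at h
    exact eq_zero_of_hildForm_eq_zero (hθ'.1 0) (hθ'.1 1) (hθ'.1 2) (hθ'.1 3) (hθ'.1 4)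
      (sum_lt_pi hθ') (hx _) (hx _) (hx _) h3 h4 h
  -- Two adjacent positive coordinates force two adjacent zeros elsewhere. Otherwise, if no two
  -- zeros were adjacent either, zero and positive coordinates would alternate around a cycle of odd
  -- length.
  by_cases hp : ∃ k, 0 < x (3 + k) ∧ 0 < x (4 + k)
  · obtain ⟨k, h3, h4⟩ := hp
    obtain ⟨h1, h0 | h2⟩ := key k h3 h4
    · refine ⟨k + 2, ?_, ?_⟩
      · rwa [show 3 + (k + 2) = 0 + k by fin_cases k <;> rfl]
      · rwa [show 4 + (k + 2) = 1 + k by fin_cases k <;> rfl]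
    · refine ⟨k + 3, ?_, ?_⟩
      · rwa [show 3 + (k + 3) = 1 + k by fin_cases k <;> rfl]
      · rwa [show 4 + (k + 3) = 2 + k by fin_cases k <;> rfl]
  · by_contra! hn
    have hz : ∀ i, x i = 0 ∨ 0 < x i := fun i => (hx i).eq_or_lt.imp Eq.symm id
    have n (k : Fin 5) : x (3 + k) = 0 ↔ x (4 + k) ≠ 0 := by
      refine ⟨hn k, fun h4 => (hz (3 + k)).resolve_right fun h3 => hp ⟨k, h3, ?_⟩⟩
      exact (hz (4 + k)).resolve_left h4
    have n0 : x 3 = 0 ↔ x 4 ≠ 0 := n 0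
    have n1 : x 4 = 0 ↔ x 0 ≠ 0 := n 1
    have n2 : x 0 = 0 ↔ x 1 ≠ 0 := n 2
    have n3 : x 1 = 0 ↔ x 2 ≠ 0 := n 3
    have n4 : x 2 = 0 ↔ x 3 ≠ 0 := n 4
    tauto

/-- The nonnegative zeros of a Hildebrand form are the multiples of the columns of `hildS`. -/
theorem exists_eq_column {θ x : Fin 5 → ℝ} (hθ : θ ∈ angles) (hx : ∀ i, 0 ≤ x i)
    (h : hildQuad θ x = 0) :
    ∃ k t, 0 ≤ t ∧ ∀ i, x i = t * hildS (fun i => θ (i + 2)) i k := by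
  obtain ⟨k, h3, h4⟩ := exists_zero_pair hθ hx h
  have hθ' := angles_rotate hθ k
  have hs := sum_lt_pi hθ'
  have p0 := hθ'.1 0
  have p1 := hθ'.1 1
  have p2 := hθ'.1 2
  have p3 := hθ'.1 3
  have p4 := hθ'.1 4
  rw [← hildQuad_rotate θ x k, hildQuad, h3, h4] at h
  obtain ⟨t, ht, e0, e1, e2⟩ := exists_eq_smul_of_hildForm_eq_zero p0 p1 (by linarith) (hx _) h
  refine ⟨k, t, ht, fun i => ?_⟩
  clear h hθ' hs p0 p1 p2 p3 p4
  fin_cases k <;> simp at h3 h4 e0 e1 e2 <;> fin_cases i <;> simp [hildS] <;>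
    first | assumption | (rw [add_comm]; assumption)

theorem hildQuad_column (θ : Fin 5 → ℝ) (k : Fin 5) (t : ℝ) :
    hildQuad θ (fun i => t * hildS (fun i => θ (i + 2)) i k) = 0 := by
  have key (a b c d e : ℝ) : hildForm a b c d e (t * Real.sin b) (t * Real.sin (a + b))
      (t * Real.sin a) 0 0 = 0 := by
    rw [hildForm_eq a b c d e _ _ _ _ _ _ rfl]
    have hb' : Real.sin b = Real.sin (a + b) * Real.cos a - Real.cos (a + b) * Real.sin a := by
      rw [← Real.sin_sub]
      congr 1
      ring
    rw [hb']
    ring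
  rw [← hildQuad_rotate _ _ k, ← key (θ (0 + k)) (θ (1 + k)) (θ (2 + k)) (θ (3 + k)) (θ (4 + k)),
    hildQuad]
  fin_cases k <;> simp [hildS, add_comm]

theorem trace_transpose_mul_eq {m : ℕ} (B : Matrix (Fin 5) (Fin m) ℝ) (θ d : Fin 5 → ℝ) :
    Matrix.trace ((B * Bᵀ)ᵀ * (Matrix.diagonal d * hildT θ * Matrix.diagonal d)) =
      ∑ j, hildQuad θ (fun i => d i * B i j) := by
  have h : ∀ j, hildQuad θ (fun i => d i * B i j) =
      ∑ i, ∑ k, d i * B i j * (hildT θ i k * (d k * B k j)) := by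
    intro j
    rw [← dotProduct_hildT_mulVec]
    simp only [dotProduct, Matrix.mulVec, Finset.mul_sum]
  simp only [h, Matrix.trace, Matrix.diag_apply, Matrix.mul_apply (M := (B * Bᵀ)ᵀ),
    Matrix.mul_diagonal, Matrix.diagonal_mul, Matrix.transpose_apply, Matrix.mul_apply (M := B)]
  rw [Finset.sum_comm, Finset.sum_comm (s := (Finset.univ : Finset (Fin m)))]
  refine Finset.sum_congr rfl fun i _ => ?_
  rw [Finset.sum_comm (s := (Finset.univ : Finset (Fin m)))]
  refine Finset.sum_congr rfl fun k _ => ?_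
  rw [Finset.sum_mul]
  exact Finset.sum_congr rfl fun j _ => by ring

/-! ### Linear independence of the columns of `S`. -/

/-- Orthogonality to a column is a three-term recurrence; up to alternating signs, its solutions are
samples of one sinusoid at the partial sums of the angles. -/
theorem add_mul_eq_zero_step {u v w x y φ P Q : ℝ} (hx : Real.sin x ≠ 0)
    (h : u * Real.sin y + v * Real.sin (x + y) + w * Real.sin x = 0)
    (hu : u = P * Real.cos φ + Q * Real.sin φ)
    (hv : v = -(P * Real.cos (φ + x) + Q * Real.sin (φ + x))) :
    w = P * Real.cos (φ + x + y) + Q * Real.sin (φ + x + y) := by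
  refine mul_right_cancel₀ hx ?_
  rw [hu, hv] at h
  simp only [Real.cos_add, Real.sin_add] at h ⊢
  have hq := Real.sin_sq_add_cos_sq x
  linear_combination h + (P * Real.cos φ + Q * Real.sin φ) * Real.sin y * hq

/-- The columns of `hildS` are linearly independent. -/
theorem eq_zero_of_column_relations {a b c d e w₀ w₁ w₂ w₃ w₄ : ℝ} (ha : 0 < a) (hb : 0 < b)
    (hc : 0 < c) (hd : 0 < d) (he : 0 < e) (hs : a + b + c + d + e < Real.pi)
    (h₀ : w₀ * Real.sin b + w₁ * Real.sin (a + b) + w₂ * Real.sin a = 0)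
    (h₁ : w₁ * Real.sin c + w₂ * Real.sin (b + c) + w₃ * Real.sin b = 0)
    (h₂ : w₂ * Real.sin d + w₃ * Real.sin (c + d) + w₄ * Real.sin c = 0)
    (h₃ : w₃ * Real.sin e + w₄ * Real.sin (d + e) + w₀ * Real.sin d = 0)
    (h₄ : w₄ * Real.sin a + w₀ * Real.sin (e + a) + w₁ * Real.sin e = 0) :
    w₀ = 0 ∧ w₁ = 0 ∧ w₂ = 0 ∧ w₃ = 0 ∧ w₄ = 0 := by
  have sa := (Real.sin_pos_of_pos_of_lt_pi ha (by linarith)).ne'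
  have sb := (Real.sin_pos_of_pos_of_lt_pi hb (by linarith)).ne'
  have sc := (Real.sin_pos_of_pos_of_lt_pi hc (by linarith)).ne'
  have sd := (Real.sin_pos_of_pos_of_lt_pi hd (by linarith)).ne'
  have se := (Real.sin_pos_of_pos_of_lt_pi he (by linarith)).ne'
  obtain ⟨P, hP⟩ : ∃ P, P = w₀ := ⟨_, rfl⟩
  obtain ⟨Q, hQ⟩ : ∃ Q, w₁ = -(P * Real.cos a + Q * Real.sin a) :=
    ⟨-(w₁ + P * Real.cos a) / Real.sin a, by field_simp; ring⟩
  have e0 : w₀ = P * Real.cos 0 + Q * Real.sin 0 := by simp [hP]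
  have e1 : w₁ = -(P * Real.cos (0 + a) + Q * Real.sin (0 + a)) := by rw [zero_add]; exact hQ
  have e2 := add_mul_eq_zero_step sa h₀ e0 e1
  have e3 := add_mul_eq_zero_step (P := -P) (Q := -Q) sb h₁ (by rw [e1]; ring) (by rw [e2]; ring)
  have e4 := add_mul_eq_zero_step sc h₂ e2 (by rw [e3]; ring)
  have e5 := add_mul_eq_zero_step (P := -P) (Q := -Q) sd h₃ (by rw [e3]) (by rw [e4]; ring)
  have e6 := add_mul_eq_zero_step se h₄ e4 (by rw [e5]; ring)
  -- After five steps, an odd number, the sinusoid must have changed sign under a shift by the angle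
  -- sum. That sum lies strictly between `0` and `π`, so half of it has nonzero cosine, and `P = Q =
  -- 0` follows.
  obtain ⟨h, hh⟩ : ∃ h, 2 * h = 0 + a + b + c + d + e := ⟨(0 + a + b + c + d + e) / 2, by ring⟩
  rw [← hh] at e5 e6
  have ch : Real.cos h ≠ 0 := (Real.cos_pos_of_mem_Ioo ⟨by linarith, by linarith⟩).ne'
  have f1 : P * Real.cos h + Q * Real.sin h = 0 := by
    refine (mul_eq_zero.1 (?_ : Real.cos h * (P * Real.cos h + Q * Real.sin h) = 0)).resolve_left ch
    rw [Real.cos_two_mul, Real.sin_two_mul, ← hP] at e5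
    linarith
  have f2 : -P * Real.sin h + Q * Real.cos h = 0 := by
    rw [hQ] at e6
    refine (mul_eq_zero.1 (?_ : (Real.cos h * Real.sin a) *
      (-P * Real.sin h + Q * Real.cos h) = 0)).resolve_left (mul_ne_zero ch sa)
    rw [Real.cos_add, Real.sin_add, Real.cos_two_mul, Real.sin_two_mul] at e6
    linear_combination (-1 / 2) * e6 - Real.cos a * Real.cos h * f1
  have gP : P = 0 := by
    linear_combination Real.cos h * f1 - Real.sin h * f2 - P * Real.sin_sq_add_cos_sq h
  have gQ : Q = 0 := by
    linear_combination Real.sin h * f1 + Real.cos h * f2 - Q * Real.sin_sq_add_cos_sq h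
  subst gP gQ
  simp at e0 e1 e2 e3 e4
  exact ⟨e0, e1, e2, e3, e4⟩

theorem eq_zero_of_hildS_vecMul {θ w : Fin 5 → ℝ} (hθ : θ ∈ angles)
    (h : ∀ k, ∑ i, w i * hildS θ i k = 0) : w = 0 := by
  have h0 := h 0
  have h1 := h 1
  have h2 := h 2
  have h3 := h 3
  have h4 := h 4
  simp [Fin.sum_univ_five, hildS] at h0 h1 h2 h3 h4
  have hs := sum_lt_pi hθ
  obtain ⟨g0, g1, g2, g3, g4⟩ := eq_zero_of_column_relations (hθ.1 3) (hθ.1 4) (hθ.1 0) (hθ.1 1)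
    (hθ.1 2) (by linarith) h0 h1 (w₄ := w 4) (by linarith) (by rw [add_comm (θ 1)]; linarith)
    (by linarith)
  funext i
  fin_cases i <;> assumption

/-! ### The interior of the doubly nonnegative cone. -/

/-- An interior point stays in the cone after subtracting a small multiple of the all-ones matrix.
-/
theorem pos_of_mem_doublyNonnegInterior {n : ℕ} {A : Matrix (Fin n) (Fin n) ℝ}
    (hA : A ∈ doublyNonnegInterior n) (i j : Fin n) : 0 < A i j := by
  obtain ⟨a, ha, rfl⟩ := hA
  let J : symMatrices n := ⟨Matrix.of fun _ _ => 1, by ext i j; rfl⟩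
  have hc : Continuous fun t : ℝ => a - t • J := by fun_prop
  have hev : ∀ᶠ t in nhds (0 : ℝ), a - t • J ∈
      (Subtype.val : symMatrices n → Matrix (Fin n) (Fin n) ℝ) ⁻¹' doublyNonneg n :=
    (hc.tendsto' 0 a (by simp)).eventually (mem_interior_iff_mem_nhds.1 ha)
  obtain ⟨ε, hε, hb⟩ := Metric.mem_nhds_iff.1 hev
  have hm : (ε / 2) ∈ Metric.ball (0 : ℝ) ε := by
    rw [Metric.mem_ball, Real.dist_eq, sub_zero, abs_of_pos (by positivity)]
    linarith
  have h1 : 0 ≤ (a.1 - (ε / 2) • J.1) i j := (hb hm).2 i j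
  simp [J] at h1
  linarith

/-- A symmetric positive definite matrix with positive entries is in the interior of the doubly
nonnegative cone. -/
theorem mem_doublyNonnegInterior {n : ℕ} {A : Matrix (Fin n) (Fin n) ℝ} (hs : A.IsSymm)
    (hp : ∀ i j, 0 < A i j) (hd : ∀ v, v ≠ 0 → 0 < v ⬝ᵥ (A *ᵥ v)) :
    A ∈ doublyNonnegInterior n := by
  refine ⟨⟨A, hs⟩, mem_interior_iff_mem_nhds.2 ?_, rfl⟩
  have h1 : ∀ᶠ M : symMatrices n in nhds ⟨A, hs⟩, ∀ v ∈ Metric.sphere (0 : Fin n → ℝ) 1,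
      0 < v ⬝ᵥ (M.1 *ᵥ v) := by
    -- Compactness of the unit sphere gives one neighbourhood that works for all directions `v`.
    refine (isCompact_sphere 0 1).eventually_forall_of_forall_eventually fun v hv => ?_
    have hc : Continuous fun z : symMatrices n × (Fin n → ℝ) => z.2 ⬝ᵥ (z.1.1 *ᵥ z.2) := by
      fun_prop
    refine hc.continuousAt.eventually (lt_mem_nhds (hd v ?_))
    rintro rfl
    simp at hv
  have h2 : ∀ᶠ M : symMatrices n in nhds ⟨A, hs⟩, ∀ i j, 0 < M.1 i j := by
    refine Filter.eventually_all.2 fun i => Filter.eventually_all.2 fun j => ?_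
    have hc : Continuous fun z : symMatrices n => z.1 i j :=
      continuous_subtype_val.matrix_elem i j
    exact hc.continuousAt.eventually (lt_mem_nhds (hp i j))
  filter_upwards [h1, h2] with M hM1 hM2
  refine ⟨Matrix.posSemidef_iff_dotProduct_mulVec.2 ⟨?_, fun v => ?_⟩, fun i j => (hM2 i j).le⟩
  · rw [Matrix.IsHermitian, Matrix.conjTranspose_eq_transpose_of_trivial]
    exact M.2
  · rw [star_trivial]
    rcases eq_or_ne v 0 with rfl | hv
    · simp
    · have hn : 0 < ‖v‖ := norm_pos_iff.2 hv
      have := hM1 (‖v‖⁻¹ • v) (by simp [norm_smul, hn.ne'])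
      rw [Matrix.mulVec_smul, smul_dotProduct, dotProduct_smul, smul_smul] at this
      exact (pos_of_smul_pos_left this (by positivity)).le

/-! ### The Hildebrand locus as an image under `φ`. -/

theorem hildS_nonneg {θ : Fin 5 → ℝ} (hθ : θ ∈ angles) (i k : Fin 5) : 0 ≤ hildS θ i k := by
  have hs := sum_lt_pi hθ
  have p0 := hθ.1 0
  have p1 := hθ.1 1
  have p2 := hθ.1 2
  have p3 := hθ.1 3
  have p4 := hθ.1 4
  fin_cases i <;> fin_cases k <;> simp [hildS] <;>
    exact Real.sin_nonneg_of_nonneg_of_le_pi (by linarith) (by linarith)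

theorem hildS_pos {θ : Fin 5 → ℝ} (hθ : θ ∈ angles) (p : WIndex) :
    0 < hildS θ p.1.2 p.1.1 := by
  have hs := sum_lt_pi hθ
  have p0 := hθ.1 0
  have p1 := hθ.1 1
  have p2 := hθ.1 2
  have p3 := hθ.1 3
  have p4 := hθ.1 4
  obtain ⟨⟨k, i⟩, h⟩ := p
  fin_cases k <;> fin_cases i <;> first
    | exact absurd h (by decide)
    | (simp [hildS]; exact Real.sin_pos_of_pos_of_lt_pi (by linarith) (by linarith))

/-- Column `l` is supported on rows `l`, `l + 1`, `l + 2`, so only column `k` meets both rows `k`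
and `k + 2`. This is what identifies columns and shows that each one is needed. -/
theorem hildS_mul_hildS_eq_zero (θ : Fin 5 → ℝ) {k l : Fin 5} (h : l ≠ k) :
    hildS θ k l * hildS θ (k + 2) l = 0 := by
  fin_cases k <;> fin_cases l <;> first
    | exact absurd rfl h
    | simp [hildS]

theorem wMatrix_mul_wMatrix_eq_zero (y : WIndex → ℝ) {k l : Fin 5} (h : l ≠ k) :
    wMatrix y k l * wMatrix y (k + 2) l = 0 := by
  fin_cases k <;> fin_cases l <;> first
    | exact absurd rfl h
    | simp [wMatrix]

theorem phi_mem_hildLocus {y : WIndex → ℝ} (hy : y ∈ hildFactors) : phi y ∈ hildLocus := by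
  obtain ⟨θ, hθ, d₁, d₂, h₁, h₂, h⟩ := hy
  have hent : ∀ i k, wMatrix y i k = d₁ i * hildS θ i k * d₂ k := by
    intro i k
    rw [h, Matrix.mul_diagonal, Matrix.diagonal_mul]
  have hnn : ∀ i k, 0 ≤ wMatrix y i k := by
    intro i k
    rw [hent]
    exact mul_nonneg (mul_nonneg (h₁ i).le (hildS_nonneg hθ i k)) (h₂ k).le
  refine ⟨⟨⟨5, wMatrix y, hnn, rfl⟩, mem_doublyNonnegInterior ?_ ?_ ?_⟩,
    -- Zeros of the form at `Θ` are columns of `S` with angles shifted by 2; the shift by 3 undoes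
    -- this modulo 5.
    fun i => θ (i + 3), angles_rotate hθ 3, fun i => (d₁ i)⁻¹, fun i => inv_pos.2 (h₁ i), ?_⟩
  · exact Matrix.isSymm_mul_transpose_self _
  · intro i j
    -- Any two indices modulo 5 lie in a common window of three consecutive ones, so some column is
    -- positive in both rows.
    obtain ⟨k, hi, hj⟩ : ∃ k : Fin 5, (i = k ∨ i = k + 1 ∨ i = k + 2) ∧
        (j = k ∨ j = k + 1 ∨ j = k + 2) := by
      revert i j
      decide
    rw [phi, Matrix.mul_apply]
    refine Finset.sum_pos' (fun l _ => mul_nonneg (hnn i l) (hnn j l)) ⟨k, Finset.mem_univ k, ?_⟩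
    have pi := hildS_pos hθ (ix k i hi)
    have pj := hildS_pos hθ (ix k j hj)
    rw [Matrix.transpose_apply, hent, hent]
    exact mul_pos (mul_pos (mul_pos (h₁ i) pi) (h₂ k)) (mul_pos (mul_pos (h₁ j) pj) (h₂ k))
  · intro v hv
    rw [phi, ← Matrix.mulVec_mulVec, Matrix.dotProduct_mulVec, ← Matrix.mulVec_transpose]
    refine lt_of_le_of_ne (Finset.sum_nonneg fun i _ => mul_self_nonneg _) fun h0 => hv ?_
    have hz := dotProduct_self_eq_zero.1 h0.symm
    have hw := eq_zero_of_hildS_vecMul (w := fun i => v i * d₁ i) hθ fun k => by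
      have := congrFun hz k
      simp only [Matrix.mulVec, dotProduct, Matrix.transpose_apply, hent, Pi.zero_apply] at this
      refine mul_right_cancel₀ (h₂ k).ne' ?_
      rw [zero_mul, ← this, Finset.sum_mul]
      exact Finset.sum_congr rfl fun i _ => by ring
    funext i
    exact (mul_eq_zero.1 (congrFun hw i)).resolve_right (h₁ i).ne'
  · rw [phi, trace_transpose_mul_eq]
    refine Finset.sum_eq_zero fun k _ => ?_
    convert hildQuad_column (fun i => θ (i + 3)) k (d₂ k) using 2
    funext i
    have e : (fun i => θ (i + 2 + 3)) = θ := by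
      funext i
      rw [add_assoc]
      exact congrArg θ (by fin_cases i <;> rfl)
    simp only [e, hent]
    have := (h₁ i).ne'
    field_simp

/-- The columns of a nonnegative factor of a matrix in the Hildebrand locus are, up to a common row
scaling, nonnegative multiples of the columns of some `hildS`. -/
theorem exists_columns {m : ℕ} {B : Matrix (Fin 5) (Fin m) ℝ} (hB : ∀ i j, 0 ≤ B i j)
    (h : B * Bᵀ ∈ hildLocus) :
    ∃ θ ∈ angles, ∃ d : Fin 5 → ℝ, (∀ i, 0 < d i) ∧ ∃ (κ : Fin m → Fin 5) (t : Fin m → ℝ),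
      (∀ j, 0 ≤ t j) ∧ ∀ i j, B i j = d i * hildS θ i (κ j) * t j := by
  obtain ⟨-, θ, hθ, d, hd, h0⟩ := h
  rw [trace_transpose_mul_eq] at h0
  have hnn : ∀ i j, 0 ≤ d i * B i j := fun i j => mul_nonneg (hd i).le (hB i j)
  rw [Finset.sum_eq_zero_iff_of_nonneg fun j _ => hildQuad_nonneg hθ fun i => hnn i j] at h0
  choose κ t ht hκ using fun j => exists_eq_column hθ (fun i => hnn i j) (h0 j (Finset.mem_univ j))
  refine ⟨_, angles_rotate hθ 2, fun i => (d i)⁻¹, fun i => inv_pos.2 (hd i), κ, t, ht,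
    fun i j => ?_⟩
  have := hκ j i
  have := (hd i).ne'
  field_simp
  linarith

theorem mem_hildFactors_of_phi_mem {y : WIndex → ℝ} (hy : y ∈ wNonneg)
    (h : phi y ∈ hildLocus) : y ∈ hildFactors := by
  have hnn : ∀ i k, 0 ≤ wMatrix y i k := by
    intro i k
    fin_cases i <;> fin_cases k <;> first | exact le_rfl | exact hy _
  obtain ⟨θ, hθ, d, hd, κ, t, ht, hent⟩ := exists_columns hnn h
  have hpos := pos_of_mem_doublyNonnegInterior h.1.2
  have hne : ∀ k, wMatrix y k k * wMatrix y (k + 2) k ≠ 0 := by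
    intro k h0
    refine (hpos k (k + 2)).ne' ?_
    rw [phi, Matrix.mul_apply]
    refine Finset.sum_eq_zero fun l _ => ?_
    rw [Matrix.transpose_apply]
    rcases eq_or_ne l k with rfl | hl
    · exact h0
    · exact wMatrix_mul_wMatrix_eq_zero y hl
  -- Column `k` of `X` is nonzero in rows `k` and `k + 2`, and only column `k` of `S` has that
  -- property.
  have hκ : ∀ k, κ k = k := by
    intro k
    by_contra hk
    refine hne k ?_
    rw [hent, hent]
    linear_combination (d k * t k * d (k + 2) * t k) * hildS_mul_hildS_eq_zero θ hk
  refine ⟨θ, hθ, d, t, hd, fun k => lt_of_le_of_ne (ht k) fun h0 => hne k ?_, ?_⟩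
  · rw [hent, ← h0, mul_zero, zero_mul]
  · ext i k
    rw [Matrix.mul_diagonal, Matrix.diagonal_mul, hent, hκ]

theorem exists_phi_eq {A : Matrix (Fin 5) (Fin 5) ℝ} (hA : A ∈ hildLocus) :
    ∃ y ∈ hildFactors, phi y = A := by
  obtain ⟨m, B, hB, rfl⟩ := hA.1.1
  obtain ⟨θ, hθ, d, hd, κ, t, ht, hent⟩ := exists_columns hB hA
  -- All columns of `B` assigned to column `k` of `S` merge into a single column with multiplier
  -- `√(w k)`, without changing `B Bᵀ`.
  let w : Fin 5 → ℝ := fun k => ∑ j with κ j = k, t j ^ 2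
  have hw0 : ∀ k, 0 ≤ w k := fun k => Finset.sum_nonneg fun j _ => sq_nonneg _
  have hBB : ∀ i l, (B * Bᵀ) i l = ∑ k, d i * hildS θ i k * (d l * hildS θ l k) * w k := by
    intro i l
    rw [Matrix.mul_apply, ← Finset.sum_fiberwise_of_maps_to (g := κ) (t := Finset.univ)
      (fun j _ => Finset.mem_univ _)]
    refine Finset.sum_congr rfl fun k _ => ?_
    rw [Finset.mul_sum]
    refine Finset.sum_congr rfl fun j hj => ?_
    rw [Matrix.transpose_apply, hent, hent, (Finset.mem_filter.1 hj).2]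
    ring
  have hw : ∀ k, 0 < w k := by
    intro k
    refine lt_of_le_of_ne (hw0 k) fun h0 => ?_
    refine (pos_of_mem_doublyNonnegInterior hA.1.2 k (k + 2)).ne' ?_
    rw [hBB]
    refine Finset.sum_eq_zero fun l _ => ?_
    rcases eq_or_ne l k with rfl | hl
    · rw [← h0, mul_zero]
    · linear_combination (d k * d (k + 2) * w l) * hildS_mul_hildS_eq_zero θ hl
  let y : WIndex → ℝ := fun p => d p.1.2 * hildS θ p.1.2 p.1.1 * Real.sqrt (w p.1.1)
  have hy : wMatrix y = Matrix.diagonal d * hildS θ * Matrix.diagonal fun k => Real.sqrt (w k) :=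
    wMatrix_eq_iff.2 fun _ => rfl
  refine ⟨y, ⟨θ, hθ, d, _, hd, fun k => Real.sqrt_pos.2 (hw k), hy⟩, ?_⟩
  ext i l
  rw [hBB, phi, hy, Matrix.mul_apply]
  refine Finset.sum_congr rfl fun k _ => ?_
  rw [Matrix.transpose_apply]
  simp only [Matrix.mul_diagonal, Matrix.diagonal_mul]
  linear_combination (d i * hildS θ i k * (d l * hildS θ l k)) * Real.mul_self_sqrt (hw0 k)

theorem hildLocus_eq : hildLocus = phi '' hildFactors := by
  ext A
  constructor
  · exact exists_phi_eq
  · rintro ⟨y, hy, rfl⟩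
    exact phi_mem_hildLocus hy

theorem hildFactors_subset_wNonneg : hildFactors ⊆ wNonneg := by
  rintro y ⟨θ, hθ, d₁, d₂, h₁, h₂, h⟩ p
  rw [wMatrix_eq_iff] at h
  rw [h]
  exact mul_nonneg (mul_nonneg (h₁ _).le (hildS_nonneg hθ _ _)) (h₂ _).le

end CPFive

end

/-- The Hildebrand locus `V_Hi` is an irreducible hypersurface in `Sym₅` (up to Zariski closure);
it is exactly the set of all `X Xᵀ` with `X = D₁ S(Θ) D₂`, and these `X` are exactly the nonnegative
elements of `W` which `φ` sends into `V_Hi`; the matrices `D₁ S(Θ) D₂` have the irreducible binomial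
hypersurface `Z_Hi ⊆ W` as their Zariski closure; and `V_Hi` and `φ(Z_Hi)` have the same Zariski
closure, whether `W` is taken with all real entries or with nonnegative entries only. -/
theorem mainTheorem3 :
    (Irreducible CPFive.hildBinomial ∧
      MvPolynomial.vanishingIdeal ℝ CPFive.hildZ = Ideal.span {CPFive.hildBinomial}) ∧
    CPFive.IsZariskiHypersurface (CPFive.symCoord '' CPFive.hildLocus) ∧
    CPFive.hildLocus = CPFive.phi '' CPFive.hildFactors ∧
    (∀ y ∈ CPFive.wNonneg, CPFive.phi y ∈ CPFive.hildLocus ↔ y ∈ CPFive.hildFactors) ∧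
    CPFive.zariskiClosure CPFive.hildFactors = CPFive.hildZ ∧
    CPFive.zariskiClosure (CPFive.symCoord '' CPFive.hildLocus) =
      CPFive.zariskiClosure (CPFive.symCoord '' (CPFive.phi '' CPFive.hildZ)) ∧
    CPFive.zariskiClosure (CPFive.symCoord '' CPFive.hildLocus) =
      CPFive.zariskiClosure
        (CPFive.symCoord '' (CPFive.phi '' (CPFive.hildZ ∩ CPFive.wNonneg))) := by
  exact ⟨⟨CPFive.irreducible_hildBinomial, CPFive.vanishingIdeal_hildZ⟩,
    CPFive.hildLocus_eq ▸ CPFive.isZariskiHypersurface_phi_hildFactors, CPFive.hildLocus_eq,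
    fun y hy => ⟨CPFive.mem_hildFactors_of_phi_mem hy, CPFive.phi_mem_hildLocus⟩,
    CPFive.zariskiClosure_hildFactors,
    CPFive.hildLocus_eq ▸ CPFive.zariskiClosure_phi_image CPFive.hildFactors_subset_hildZ
      subset_rfl,
    CPFive.hildLocus_eq ▸ CPFive.zariskiClosure_phi_image
      (Set.subset_inter CPFive.hildFactors_subset_hildZ CPFive.hildFactors_subset_wNonneg)
      Set.inter_subset_left⟩
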